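/- Let $Z\in\mathbb{R}^{(d+1)\times(d+1)}$ be the lower shift matrix. For $G\in\mathbb{R}^{(d+1)\times 2}$ consider the following algorithm. Put $G_0=G$; for $k=0,1,\dots,d$ compute a right QR decomposition $G_k=R_kQ_k$ with $Q_k$ a $2\times2$ orthogonal matrix (a plane rotation or a Householder reflection; $Q_k=I$ if row $k$ of $G_k$ is zero) such that row $k$ of $R_k=[\mathbf{u}_k,\mathbf{v}_k]$ has the form $[*,0]$, let column $k$ of $L$ be $\mathbf{u}_k/u_{k,k}$, and put $G_{k+1}=[Z\mathbf{u}_k,\mathbf{v}_k]$. Quantities with a hat are those computed when the algorithm is executed in floating point arithmetic of machine precision $\epsilon_{\mathrm{ma}}$, i.e. when every operation $+,-,\times,/,\sqrt{\cdot}$ is carried out with a relative error of at most $\epsilon_{\mathrm{ma}}$; $\hat u_{k,k}$ is entry $k$ of the computed $\hat{\mathbf u}_k$, and $\hat H=\mathrm{diag}(\hat u_{0,0},\dots,\hat u_{d,d})$. The algorithm breaks down if some $\hat u_{k,k}$ is $0$. Let $\|\cdot\|_F$ be the Frobenius norm. There are absolute constants $C,c>0$ such that the following holds for all $d\ge 1$,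 every floating point arithmetic of precision $\epsilon_{\mathrm{ma}}$, and either choice of the QR decomposition. Let $G\in\mathbb{R}^{(d+1)\times 2}$ and let $K$ satisfy $K-ZKZ^T=GG^T$. (a) (Backward error.) If $d\,\epsilon_{\mathrm{ma}}\le c$ and the algorithm does not break down, then $$\|\hat L\hat H^2\hat L^T-K\|_F\le C\,d^3\,\|G\|_F^2\,\epsilon_{\mathrm{ma}} .$$ (b) (Forward error.) Let $\eta>0$ be such that all eigenvalues of $K$ lie in $[1,\eta^{-1}]$, and suppose that $d^3\eta^{-1/2}\|G\|_F^2\,\epsilon_{\mathrm{ma}}\le c$. Then the algorithm does not break down, and if $K=LDL^T$ is the LDL decomposition of $K$ ($L$ unit lower triangular, $D$ diagonal), then $$\|\hat L-L\|_F\le C\,d^3\,\eta^{-1}\,\|G\|_F^2\,\epsilon_{\mathrm{ma}} .$$ (c) (Forward error for quantum signal processing.) Let $0<\eta<1$ and let $f$ be an even real polynomial of degree at most $2d$ with $|f|\le 1-\eta$ on $[-1,1]$. Put $b(z)=\mathrm{i}f(\cos\theta)$ for $z=e^{2\mathrm{i}\theta}$, and let $a$ be the polynomial in $z^{-1}$ that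 has no zeros in $|z|>1$, satisfies $a(\infty)>0$, and satisfies $|a|^2+|b|^2=1$ on $|z|=1$. Let $c_k$ be the coefficient of $z^k$ in the Laurent series of $b/a$ on $|z|=1$ (these are purely imaginary), let $\mathbf p=-\mathrm{i}(c_d,\dots,c_0)^T\in\mathbb{R}^{d+1}$, let $B$ be the lower triangular Toeplitz matrix with first column $\mathbf p$, and put $G=[\mathbf e_0,\mathbf p]$ with $\mathbf e_0=(1,0,\dots,0)^T$, and $K=I+BB^T$. If $d^3\eta^{-1/2}\|G\|_F^2\,\epsilon_{\mathrm{ma}}\le c$, then the conclusion of (b) holds. -/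

import Mathlib

/- Matrix norms below are Frobenius norms. -/
attribute [local instance] Matrix.frobeniusNormedAddCommGroup

namespace HalfCholesky

open Matrix

/-- The standard model of floating point arithmetic with machine precision `ε`: each of the five
elementary operations returns the exact result up to a relative error of at most `ε`.
The operations are total functions on `ℝ`: operations given only on a set of machine numbers
can be extended by the exact ones. Nothing is assumed about division by zero or
about square roots of negative numbers. -/
structure FloatArith (ε : ℝ) where
  add : ℝ → ℝ → ℝ
  sub : ℝ → ℝ → ℝ
  mul : ℝ → ℝ → ℝ
  div : ℝ → ℝ → ℝ
  sqrt : ℝ → ℝ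
  add_err : ∀ x y, ∃ δ : ℝ, |δ| ≤ ε ∧ add x y = (x + y) * (1 + δ)
  sub_err : ∀ x y, ∃ δ : ℝ, |δ| ≤ ε ∧ sub x y = (x - y) * (1 + δ)
  mul_err : ∀ x y, ∃ δ : ℝ, |δ| ≤ ε ∧ mul x y = (x * y) * (1 + δ)
  div_err : ∀ x y, y ≠ 0 → ∃ δ : ℝ, |δ| ≤ ε ∧ div x y = (x / y) * (1 + δ)
  sqrt_err : ∀ x, 0 ≤ x → ∃ δ : ℝ, |δ| ≤ ε ∧ sqrt x = Real.sqrt x * (1 + δ)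

/-- The lower shift matrix `Z`. -/
def lowerShift (d : ℕ) : Matrix (Fin (d + 1)) (Fin (d + 1)) ℝ :=
  Matrix.of fun i j => if (i : ℕ) = (j : ℕ) + 1 then 1 else 0

section Algorithm

variable {ε : ℝ} (A : FloatArith ε) {d : ℕ}

/-- The computed length of the vector `(a, b)`. -/
def flLength (a b : ℝ) : ℝ := A.sqrt (A.add (A.mul a a) (A.mul b b))

/-- Right QR decomposition `G = R Q` with pivot row `k`, by a plane rotation `Q ∈ SO(2)`:
the computed `R`, whose row `k` has the form `[*, 0]`. -/
def rotationQR (k : Fin (d + 1)) (G : Matrix (Fin (d + 1)) (Fin 2) ℝ) :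
    Matrix (Fin (d + 1)) (Fin 2) ℝ :=
  let a := G k 0
  let b := G k 1
  let r := flLength A a b
  let co := A.div a r
  let si := A.div b r
  Matrix.of fun i =>
    if i = k then ![r, 0]
    else ![A.add (A.mul co (G i 0)) (A.mul si (G i 1)),
           A.sub (A.mul co (G i 1)) (A.mul si (G i 0))]

/-- Right QR decomposition `G = R Q` with pivot row `k`, by a Householder reflection
`Q = I - β w wᵀ`, where `w = (a + σ, b)`, `σ = ± ‖(a, b)‖` has the sign of `a`,
and `β = 2 / ‖w‖² = 1 / (σ (a + σ))`: the computed `R`, whose row `k` is `[-σ, 0]`. -/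
noncomputable def householderQR (k : Fin (d + 1)) (G : Matrix (Fin (d + 1)) (Fin 2) ℝ) :
    Matrix (Fin (d + 1)) (Fin 2) ℝ :=
  let a := G k 0
  let b := G k 1
  let σ := if 0 ≤ a then flLength A a b else -flLength A a b
  let w := A.add a σ
  let β := A.div 1 (A.mul σ w)
  Matrix.of fun i =>
    if i = k then ![-σ, 0]
    else
      let t := A.mul β (A.add (A.mul w (G i 0)) (A.mul b (G i 1)))
      ![A.sub (G i 0) (A.mul t w), A.sub (G i 1) (A.mul t b)]

/-- The two standard ways to carry out the right QR decomposition. -/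
inductive QRMethod where
  | rotation
  | householder

/-- The computed factor `R` of the right QR decomposition `G = R Q` with pivot row `k`.
If the pivot row vanishes already, then `Q = I`. -/
noncomputable def qrFactor (m : QRMethod) (k : Fin (d + 1)) (G : Matrix (Fin (d + 1)) (Fin 2) ℝ) :
    Matrix (Fin (d + 1)) (Fin 2) ℝ :=
  if G k 0 = 0 ∧ G k 1 = 0 then G
  else match m with
    | .rotation => rotationQR A k G
    | .householder => householderQR A k G

/-- One pass `G_k ↦ G_{k+1} = [Z u_k, v_k]` of the loop, where `R_k = [u_k, v_k]`.
The shift only moves data and is free of rounding errors. -/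
noncomputable def nextGenerator (m : QRMethod) (k : Fin (d + 1)) (G : Matrix (Fin (d + 1)) (Fin 2) ℝ) :
    Matrix (Fin (d + 1)) (Fin 2) ℝ :=
  let R := qrFactor A m k G
  Matrix.of fun i => ![(lowerShift d *ᵥ fun j => R j 0) i, R i 1]

/-- The computed generators `Ĝ_0 = G, Ĝ_1, …` (only the indices `k ≤ d` are used). -/
noncomputable def generator (m : QRMethod) (G : Matrix (Fin (d + 1)) (Fin 2) ℝ) :
    ℕ → Matrix (Fin (d + 1)) (Fin 2) ℝ
  | 0 => G
  | k + 1 => nextGenerator A m (Fin.ofNat (d + 1) k) (generator m G k)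

/-- The computed matrix `Û = [û_0, …, û_d]`, where `û_k` is the first column of `R̂_k`. -/
noncomputable def computedU (m : QRMethod) (G : Matrix (Fin (d + 1)) (Fin 2) ℝ) :
    Matrix (Fin (d + 1)) (Fin (d + 1)) ℝ :=
  Matrix.of fun i k => qrFactor A m k (generator A m G k) i 0

/-- The computed factor `L̂`: its column `k` is `û_k` divided by `û_{kk}`. -/
noncomputable def computedL (m : QRMethod) (G : Matrix (Fin (d + 1)) (Fin 2) ℝ) :
    Matrix (Fin (d + 1)) (Fin (d + 1)) ℝ :=
  Matrix.of fun i k => A.div (computedU A m G i k) (computedU A m G k k)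

/-- The diagonal matrix `Ĥ = diag(û_{00}, …, û_{dd})`. -/
noncomputable def computedH (m : QRMethod) (G : Matrix (Fin (d + 1)) (Fin 2) ℝ) :
    Matrix (Fin (d + 1)) (Fin (d + 1)) ℝ :=
  Matrix.diagonal fun k => computedU A m G k k

/-- The algorithm runs to completion: no division by zero occurs when `L̂` is formed. -/
def NoBreakdown (m : QRMethod) (G : Matrix (Fin (d + 1)) (Fin 2) ℝ) : Prop :=
  ∀ k, computedU A m G k k ≠ 0

end Algorithm

/-- `K = L D Lᵀ` is the LDL decomposition of `K`, with `L` unit lower triangular and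
`D = diag(δ_0, …, δ_d)`. -/
def IsLDL {d : ℕ} (K L : Matrix (Fin (d + 1)) (Fin (d + 1)) ℝ) (δ : Fin (d + 1) → ℝ) : Prop :=
  (∀ i, L i i = 1) ∧ (∀ i j, i < j → L i j = 0) ∧ K = L * Matrix.diagonal δ * Lᵀ

/-- `f` is an even real polynomial of degree at most `2 d` with `|f| ≤ 1 - η` on `[-1, 1]`. -/
def IsTarget (d : ℕ) (η : ℝ) (f : Polynomial ℝ) : Prop :=
  f.natDegree ≤ 2 * d ∧ f.comp (-Polynomial.X) = f ∧ ∀ x ∈ Set.Icc (-1 : ℝ) 1, |f.eval x| ≤ 1 - η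

/-- With `z = e^{it}` and `b(z) = i f(cos (t/2))`, the function `a(z) = P(1/z)`, a polynomial in
`1/z`, is the outer function on `{|z| > 1} ∪ {∞}` with `a(∞) > 0` and
`a a* + b b* = 1` on the unit circle. (A polynomial is outer on the unit disk if and only if it has
no zero there.) -/
def IsOuterComplement (f : Polynomial ℝ) (P : Polynomial ℂ) : Prop :=
  (∀ w : ℂ, ‖w‖ < 1 → P.eval w ≠ 0) ∧
  ((P.eval 0).im = 0 ∧ 0 < (P.eval 0).re) ∧
  ∀ t : ℝ, ‖P.eval (Complex.exp (-(t * Complex.I)))‖ ^ 2 + (f.eval (Real.cos (t / 2))) ^ 2 = 1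

/-- The coefficient `c_k` of `z^k` in the Laurent series of `b / a` on the unit circle. -/
noncomputable def laurentCoeff (f : Polynomial ℝ) (P : Polynomial ℂ) (k : ℤ) : ℂ :=
  (1 / (2 * Real.pi) : ℝ) *
    ∫ t in (0 : ℝ)..(2 * Real.pi),
      Complex.I * (f.eval (Real.cos (t / 2)) : ℝ) / P.eval (Complex.exp (-(t * Complex.I))) *
        Complex.exp (-(k * t * Complex.I))

/-- The vector `p = -i (c_d, …, c_0)ᵀ`. The coefficients `c_k` are purely imaginary, so `p` is real,
and taking real parts changes nothing but the type. -/
noncomputable def pVec (d : ℕ) (f : Polynomial ℝ) (P : Polynomial ℂ) : Fin (d + 1) → ℝ :=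
  fun j => (-Complex.I * laurentCoeff f P ((d : ℤ) - (j : ℤ))).re

/-- The lower triangular Toeplitz matrix with first column `p`. -/
def lowerToeplitz {d : ℕ} (p : Fin (d + 1) → ℝ) : Matrix (Fin (d + 1)) (Fin (d + 1)) ℝ :=
  Matrix.of fun i j => if j ≤ i then p (i - j) else 0

/-- The matrix `[e_0, p]`. -/
def startGenerator {d : ℕ} (p : Fin (d + 1) → ℝ) : Matrix (Fin (d + 1)) (Fin 2) ℝ :=
  Matrix.of fun i => ![if i = 0 then 1 else 0, p i]

end HalfCholesky

open HalfCholesky Matrix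

/-! Backward error. A computed QR step is close, row by row, to an exact factor `R` with `R Rᵀ = G_k
G_kᵀ`, so it perturbs `G_k G_kᵀ` by `O(ε ‖G_k‖²)` (`qrFactor_error`). Passing from `R̂_k` to
`Ĝ_{k+1}` replaces `u uᵀ` by `Z u uᵀ Zᵀ` exactly (`step_identity`). Summed over `k` this telescopes,
and the last generator is exactly zero, because the relative error model never disturbs a zero
(`generator_last`). Hence the displacement of `K - Û Ûᵀ` is the sum of the `d + 1` local errors
(`displacement_residual`). Since `Z` is a nilpotent contraction, the displacement operator has an
inverse of norm at most `d + 1` (`norm_le_of_displacement`). Thus `Û Ûᵀ - K` is of order `d² ‖G‖²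
ε`, and forming `L̂` adds only one relative error per entry.

Forward error. If `K ≥ 1` and `‖Û Ûᵀ - K‖ ≤ 1/2`, the triangular matrix `Û` is invertible, which
excludes breakdown. The exact identity `triangular_factor_sub` expresses the difference of two
normalized triangular factors through the strictly lower part of `U⁻¹ E V⁻ᵀ`, which gives a bound
linear in `E` (`ldl_perturbation`).

Quantum signal processing. It remains to see that `K = 1 + B Bᵀ ≤ η⁻¹`. As `a` is outer, `z^{-d} b /
a` is analytic outside the disk, so the Laurent coefficients of index above `d` vanish
(`laurentCoeff_eq_zero`). The zeros of `B` above the diagonal are therefore Laurent coefficients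
too, `B` is a finite section of a Toeplitz operator, and its norm is at most `sup |b / a| ≤ √(η⁻¹ -
1)` (`lowerToeplitz_pVec_spectralSqLe`). -/

namespace HalfCholesky

open Matrix

/-! ### Frobenius and spectral norm estimates -/

section Frobenius

variable {l m n : Type*} [Fintype l] [Fintype m] [Fintype n]

lemma frobenius_sq (A : Matrix m n ℝ) : ‖A‖ ^ 2 = ∑ i, ∑ j, A i j ^ 2 := by
  rw [frobenius_norm_def, ← Real.sqrt_eq_rpow, Real.sq_sqrt]
  · simp
  · positivity

lemma frobenius_le_of_entry {A B : Matrix m n ℝ} {s : ℝ} (hs : 0 ≤ s)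
    (h : ∀ i j, |A i j| ≤ s * |B i j|) : ‖A‖ ≤ s * ‖B‖ := by
  have h' : ‖A‖ ^ 2 ≤ (s * ‖B‖) ^ 2 := by
    rw [mul_pow, frobenius_sq, frobenius_sq, Finset.mul_sum]
    refine Finset.sum_le_sum fun i _ => ?_
    rw [Finset.mul_sum]
    refine Finset.sum_le_sum fun j _ => ?_
    rw [← mul_pow, sq_le_sq, abs_mul, abs_of_nonneg hs]
    exact h i j
  exact (sq_le_sq₀ (norm_nonneg _) (by positivity)).1 h'

/-- The spectral norm of `A` is at most `√s`. -/
def SpectralSqLe (A : Matrix m n ℝ) (s : ℝ) : Prop :=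
  ∀ x : n → ℝ, (A *ᵥ x) ⬝ᵥ (A *ᵥ x) ≤ s * (x ⬝ᵥ x)

lemma dotProduct_sq_le (x y : n → ℝ) : (x ⬝ᵥ y) ^ 2 ≤ (x ⬝ᵥ x) * (y ⬝ᵥ y) := by
  have := Finset.sum_mul_sq_le_sq_mul_sq Finset.univ x y
  simpa [dotProduct, sq] using this

lemma dotProduct_self_nonneg' (x : n → ℝ) : 0 ≤ x ⬝ᵥ x :=
  Finset.sum_nonneg fun i _ => mul_self_nonneg (x i)

lemma mulVec_dotProduct_mulVec (A : Matrix m n ℝ) (x y : n → ℝ) :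
    (A *ᵥ x) ⬝ᵥ (A *ᵥ y) = x ⬝ᵥ ((Aᵀ * A) *ᵥ y) := by
  rw [← mulVec_mulVec, dotProduct_mulVec x, vecMul_transpose]

/-- With `y = Aᵀ x` one has `|y|² = ⟨x, A y⟩`; apply Cauchy–Schwarz and cancel `|y|²`. -/
lemma SpectralSqLe.transpose {A : Matrix m n ℝ} {s : ℝ} (hs : 0 ≤ s)
    (h : SpectralSqLe A s) : SpectralSqLe Aᵀ s := by
  intro x
  set y := Aᵀ *ᵥ x with hy
  have h1 : y ⬝ᵥ y = x ⬝ᵥ (A *ᵥ y) := by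
    rw [dotProduct_mulVec x, ← mulVec_transpose]
  have h2 := dotProduct_sq_le x (A *ᵥ y)
  have h3 := h y
  have hx := dotProduct_self_nonneg' x
  have hy0 := dotProduct_self_nonneg' y
  rw [← h1] at h2
  rcases hy0.eq_or_lt with h0 | h0
  · rw [← h0]
    positivity
  · have : (y ⬝ᵥ y) ^ 2 ≤ (s * (x ⬝ᵥ x)) * (y ⬝ᵥ y) := by nlinarith
    rw [sq] at this
    exact le_of_mul_le_mul_right this h0

lemma SpectralSqLe.mul_sq_le {A : Matrix l m ℝ} {s : ℝ} (h : SpectralSqLe A s)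
    (B : Matrix m n ℝ) : ‖A * B‖ ^ 2 ≤ s * ‖B‖ ^ 2 := by
  rw [frobenius_sq, frobenius_sq, Finset.sum_comm, Finset.sum_comm (f := fun i j => B i j ^ 2),
    Finset.mul_sum]
  refine Finset.sum_le_sum fun j _ => ?_
  have := h fun i => B i j
  simpa [dotProduct, mulVec, Matrix.mul_apply, sq] using this

lemma SpectralSqLe.norm_mul_le {A : Matrix l m ℝ} {s : ℝ} (hs : 0 ≤ s) (h : SpectralSqLe A s)
    (B : Matrix m n ℝ) : ‖A * B‖ ≤ √s * ‖B‖ := by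
  rw [← sq_le_sq₀ (norm_nonneg _) (by positivity), mul_pow, Real.sq_sqrt hs]
  exact h.mul_sq_le B

lemma SpectralSqLe.norm_mul_transpose_le {A : Matrix l m ℝ} {s : ℝ} (hs : 0 ≤ s)
    (h : SpectralSqLe A s) (B : Matrix n m ℝ) : ‖B * Aᵀ‖ ≤ √s * ‖B‖ := by
  rw [← frobenius_norm_transpose, transpose_mul, transpose_transpose,
    ← frobenius_norm_transpose B]
  exact h.norm_mul_le hs _

lemma abs_dotProduct_mulVec_le (A : Matrix n n ℝ) (x : n → ℝ) :
    |x ⬝ᵥ (A *ᵥ x)| ≤ ‖A‖ * (x ⬝ᵥ x) := by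
  have hx := dotProduct_self_nonneg' x
  have h1 : (A *ᵥ x) ⬝ᵥ (A *ᵥ x) ≤ ‖A‖ ^ 2 * (x ⬝ᵥ x) := by
    rw [frobenius_sq, Finset.sum_mul]
    refine Finset.sum_le_sum fun i _ => ?_
    have := dotProduct_sq_le (A i) x
    simpa [mulVec, dotProduct, sq] using this
  refine abs_le_of_sq_le_sq ?_ (by positivity)
  calc (x ⬝ᵥ (A *ᵥ x)) ^ 2 ≤ (x ⬝ᵥ x) * ((A *ᵥ x) ⬝ᵥ (A *ᵥ x)) := dotProduct_sq_le _ _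
    _ ≤ (x ⬝ᵥ x) * (‖A‖ ^ 2 * (x ⬝ᵥ x)) := by gcongr
    _ = _ := by ring

/-- The diagonal of `A Aᵀ` holds the squared row norms. This lets the orthogonal factor of a QR step
stay implicit. -/
lemma frobenius_eq_of_mul_transpose_eq {A B : Matrix m n ℝ} (h : A * Aᵀ = B * Bᵀ) :
    ‖A‖ = ‖B‖ := by
  rw [← sq_eq_sq₀ (norm_nonneg _) (norm_nonneg _), frobenius_sq, frobenius_sq]
  refine Finset.sum_congr rfl fun i _ => ?_
  have := congrFun (congrFun h i) i
  simpa [Matrix.mul_apply, sq] using this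

lemma norm_mul_transpose_sub_le (A B : Matrix m n ℝ) :
    ‖A * Aᵀ - B * Bᵀ‖ ≤ ‖A - B‖ * (‖A - B‖ + 2 * ‖B‖) := by
  have : A * Aᵀ - B * Bᵀ = (A - B) * (A - B)ᵀ + (A - B) * Bᵀ + B * (A - B)ᵀ := by
    simp only [transpose_sub, Matrix.mul_sub, Matrix.sub_mul]
    abel
  rw [this]
  refine (norm_add₃_le).trans ?_
  have h1 := frobenius_norm_mul (A - B) (A - B)ᵀ
  have h2 := frobenius_norm_mul (A - B) Bᵀ
  have h3 := frobenius_norm_mul B (A - B)ᵀ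
  rw [frobenius_norm_transpose] at h1 h2 h3
  linarith

end Frobenius

/-! ### The shift matrix and the displacement operator -/

section Shift

variable {d : ℕ}

lemma lowerShift_mulVec (x : Fin (d + 1) → ℝ) (i : Fin (d + 1)) :
    (lowerShift d *ᵥ x) i = Fin.cases 0 (fun j => x j.castSucc) i := by
  induction i using Fin.cases with
  | zero => simp [lowerShift, mulVec, dotProduct]
  | succ i =>
    simp only [lowerShift, mulVec, dotProduct, of_apply, Fin.val_succ, Fin.cases_succ]
    rw [Finset.sum_eq_single i.castSucc]
    · simp
    · intro j _ hj
      have : (i : ℕ) ≠ j := fun h => hj (Fin.ext (by simp [h]))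
      simp [this]
    · simp

lemma lowerShift_spectralSqLe : SpectralSqLe (lowerShift d) 1 := by
  intro x
  simp only [dotProduct, lowerShift_mulVec]
  rw [Fin.sum_univ_succ, Fin.sum_univ_castSucc (f := fun i => x i * x i)]
  simp only [Fin.cases_zero, Fin.cases_succ]
  nlinarith [mul_self_nonneg (x (Fin.last d))]

lemma lowerShift_mulVec_iterate (n : ℕ) (x : Fin (d + 1) → ℝ) (i : Fin (d + 1))
    (hi : (i : ℕ) < n) : (lowerShift d ^ n *ᵥ x) i = 0 := by
  induction n generalizing i with
  | zero => omega
  | succ n ih =>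
    rw [pow_succ', ← mulVec_mulVec, lowerShift_mulVec]
    induction i using Fin.cases with
    | zero => rfl
    | succ j => exact ih _ (by simpa using hi)

lemma lowerShift_pow_eq_zero : lowerShift d ^ (d + 1) = 0 := by
  refine Matrix.ext_of_mulVec_single fun j => ?_
  ext i
  rw [lowerShift_mulVec_iterate _ _ _ i.isLt]
  simp

lemma norm_shift_conj_le (M : Matrix (Fin (d + 1)) (Fin (d + 1)) ℝ) :
    ‖lowerShift d * M * (lowerShift d)ᵀ‖ ≤ ‖M‖ := by
  have h1 := (lowerShift_spectralSqLe (d := d)).norm_mul_transpose_le zero_le_one (lowerShift d * M)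
  have h2 := (lowerShift_spectralSqLe (d := d)).norm_mul_le zero_le_one M
  simp only [Real.sqrt_one, one_mul] at h1 h2
  exact h1.trans h2

/-- The displacement operator `X ↦ X - Z X Zᵀ` has an inverse of norm at most `d + 1`. -/
lemma norm_le_of_displacement {X M : Matrix (Fin (d + 1)) (Fin (d + 1)) ℝ}
    (h : X - lowerShift d * X * (lowerShift d)ᵀ = M) : ‖X‖ ≤ (d + 1) * ‖M‖ := by
  -- Each unrolling of `X = M + Z X Zᵀ` costs `‖M‖`, since conjugation by `Z` is a contraction. At
  -- `n = d + 1` the remainder vanishes by nilpotency.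
  have key : ∀ n : ℕ, ‖X - lowerShift d ^ n * X * (lowerShift d)ᵀ ^ n‖ ≤ n * ‖M‖ := by
    intro n
    induction n with
    | zero => simp
    | succ n ih =>
      have : X - lowerShift d ^ (n + 1) * X * (lowerShift d)ᵀ ^ (n + 1)
          = M + lowerShift d * (X - lowerShift d ^ n * X * (lowerShift d)ᵀ ^ n)
              * (lowerShift d)ᵀ := by
        rw [← h, pow_succ', pow_succ]
        noncomm_ring
      rw [this]
      refine (norm_add_le _ _).trans ?_
      have := (norm_shift_conj_le (X - lowerShift d ^ n * X * (lowerShift d)ᵀ ^ n)).trans ih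
      push_cast
      linarith
  have := key (d + 1)
  rw [lowerShift_pow_eq_zero] at this
  simpa using this

end Shift

/-! ### Calculus of rounding errors -/

section RoundingErrors

/-- `x'` approximates `x`, which is of size at most `X`, with error at most `p ε X`. -/
def Near (ε p X x' x : ℝ) : Prop := |x' - x| ≤ p * ε * X ∧ |x| ≤ X

variable {ε : ℝ}

lemma FloatArith.nonneg (A : FloatArith ε) : 0 ≤ ε := by
  obtain ⟨δ, hδ, _⟩ := A.add_err 0 0
  exact (abs_nonneg δ).trans hδ

lemma Near.refl (x : ℝ) : Near ε 0 |x| x x := by simp [Near]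

lemma Near.size_nonneg {p X x' x : ℝ} (h : Near ε p X x' x) : 0 ≤ X := (abs_nonneg x).trans h.2

lemma Near.mono {p q X Y x' x : ℝ} (h : Near ε p X x' x) (hε : 0 ≤ ε) (hq : 0 ≤ q) (hpq : p ≤ q)
    (hXY : X ≤ Y) : Near ε q Y x' x := by
  refine ⟨h.1.trans ?_, h.2.trans hXY⟩
  have := h.size_nonneg
  gcongr

lemma Near.neg {p X x' x : ℝ} (h : Near ε p X x' x) : Near ε p X (-x') (-x) := by
  refine ⟨?_, by simpa using h.2⟩
  rw [← abs_neg, show -(-x' - -x) = x' - x by ring]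
  exact h.1

lemma near_mul_one_add {e e' z z' δ Z : ℝ} (h : |z' - z| ≤ e * Z) (hz : |z| ≤ Z)
    (hδ : |δ| ≤ ε) (he : e + ε * (1 + e) ≤ e') (hZ : 0 ≤ Z) :
    |z' * (1 + δ) - z| ≤ e' * Z := by
  have hε : 0 ≤ ε := (abs_nonneg δ).trans hδ
  have h1 : |z'| ≤ (1 + e) * Z := by
    have := abs_add_le (z' - z) z
    rw [sub_add_cancel] at this
    linarith
  have h2 : |z' * δ| ≤ (1 + e) * Z * ε := by
    rw [abs_mul]
    exact mul_le_mul h1 hδ (abs_nonneg _) ((abs_nonneg _).trans h1)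
  calc |z' * (1 + δ) - z| = |(z' - z) + z' * δ| := by ring_nf
    _ ≤ |z' - z| + |z' * δ| := abs_add_le _ _
    _ ≤ (e + ε * (1 + e)) * Z := by linarith
    _ ≤ e' * Z := by gcongr

lemma Near.mul_exact {p q X Y x' x y' y : ℝ} (hε : 0 ≤ ε) (hp : 0 ≤ p)
    (hx : Near ε p X x' x) (hy : Near ε q Y y' y) :
    |x' * y' - x * y| ≤ (p * ε + q * ε + p * ε * (q * ε)) * (X * Y) := by
  have hX := hx.size_nonneg
  have hY := hy.size_nonneg
  have e : x' * y' - x * y = (x' - x) * (y' - y) + (x' - x) * y + x * (y' - y) := by ring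
  have h1 : |(x' - x) * (y' - y)| ≤ (p * ε * X) * (q * ε * Y) := by
    rw [abs_mul]; exact mul_le_mul hx.1 hy.1 (abs_nonneg _) (by positivity)
  have h2 : |(x' - x) * y| ≤ (p * ε * X) * Y := by
    rw [abs_mul]; exact mul_le_mul hx.1 hy.2 (abs_nonneg _) (by positivity)
  have h3 : |x * (y' - y)| ≤ X * (q * ε * Y) := by
    rw [abs_mul]; exact mul_le_mul hx.2 hy.1 (abs_nonneg _) hX
  rw [e]
  refine (abs_add_three _ _ _).trans ?_
  linarith

/-- For `p, q ≤ 50` the second-order terms fit, together with the new rounding error, into the extra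
`2 ε`. Error bounds then reduce to adding integers. -/
lemma mul_budget {p q : ℝ} (hε : 0 ≤ ε) (hs : ε ≤ 1 / 10000) (hp : 0 ≤ p) (hp' : p ≤ 50)
    (hq : 0 ≤ q) (hq' : q ≤ 50) :
    (p * ε + q * ε + p * ε * (q * ε)) + ε * (1 + (p * ε + q * ε + p * ε * (q * ε)))
      ≤ (p + q + 2) * ε := by
  have h1 : p * ε ≤ 1 / 200 := by nlinarith
  have h2 : q * ε ≤ 1 / 200 := by nlinarith
  have h1' : 0 ≤ p * ε := by positivity
  have h2' : 0 ≤ q * ε := by positivity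
  have h3 : p * ε * q ≤ 1 / 4 := by nlinarith
  have h4 : p * ε * (q * ε) ≤ 1 / 4 * ε := by nlinarith
  have h5 : p * ε * (q * ε) ≤ 1 / 4 := by linarith
  nlinarith

variable (A : FloatArith ε)

lemma Near.mul (hs : ε ≤ 1 / 10000)
    {p q X Y x' x y' y : ℝ} (hp : 0 ≤ p) (hp' : p ≤ 50) (hq : 0 ≤ q) (hq' : q ≤ 50)
    (hx : Near ε p X x' x) (hy : Near ε q Y y' y) :
    Near ε (p + q + 2) (X * Y) (A.mul x' y') (x * y) := by
  have hX := hx.size_nonneg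
  have hY := hy.size_nonneg
  have hxy : |x * y| ≤ X * Y := by
    rw [abs_mul]; exact mul_le_mul hx.2 hy.2 (abs_nonneg _) hX
  obtain ⟨δ, hδ, e⟩ := A.mul_err x' y'
  refine ⟨?_, hxy⟩
  rw [e]
  exact near_mul_one_add (hx.mul_exact A.nonneg hp hy) hxy hδ
    (mul_budget A.nonneg hs hp hp' hq hq') (by positivity)

lemma add_budget (hs : ε ≤ 1 / 10000) {p : ℝ} (hε : 0 ≤ ε) (hp' : p ≤ 50) :
    p * ε + ε * (1 + p * ε) ≤ (p + 2) * ε := by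
  have : p * ε ≤ 1 := by nlinarith
  nlinarith

/-- The error is measured against `X + Y`, not `|x + y|`, so cancellation does no harm. -/
lemma Near.add (hs : ε ≤ 1 / 10000) {p X Y x' x y' y : ℝ} (hp' : p ≤ 50)
    (hx : Near ε p X x' x) (hy : Near ε p Y y' y) :
    Near ε (p + 2) (X + Y) (A.add x' y') (x + y) := by
  have hX := hx.size_nonneg
  have hY := hy.size_nonneg
  have hxy : |x + y| ≤ X + Y := (abs_add_le _ _).trans (add_le_add hx.2 hy.2)
  obtain ⟨δ, hδ, e⟩ := A.add_err x' y'
  refine ⟨?_, hxy⟩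
  rw [e]
  refine near_mul_one_add (e := p * ε) ?_ hxy hδ (add_budget hs A.nonneg hp') (by positivity)
  rw [show x' + y' - (x + y) = (x' - x) + (y' - y) by ring]
  refine (abs_add_le _ _).trans ?_
  have := hx.1
  have := hy.1
  linarith

lemma Near.sub (hs : ε ≤ 1 / 10000) {p X Y x' x y' y : ℝ} (hp' : p ≤ 50)
    (hx : Near ε p X x' x) (hy : Near ε p Y y' y) :
    Near ε (p + 2) (X + Y) (A.sub x' y') (x - y) := by
  have hX := hx.size_nonneg
  have hY := hy.size_nonneg
  have hxy : |x - y| ≤ X + Y := (abs_sub _ _).trans (add_le_add hx.2 hy.2)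
  obtain ⟨δ, hδ, e⟩ := A.sub_err x' y'
  refine ⟨?_, hxy⟩
  rw [e]
  refine near_mul_one_add (e := p * ε) ?_ hxy hδ (add_budget hs A.nonneg hp') (by positivity)
  rw [show x' - y' - (x - y) = (x' - x) - (y' - y) by ring]
  refine (abs_sub _ _).trans ?_
  have := hx.1
  have := hy.1
  linarith

/-- Inversion needs a genuine relative error, hence the size `|y|`; this also keeps `y'` away from
zero. -/
lemma Near.inv (hs : ε ≤ 1 / 10000)
    {p y' y : ℝ} (hε : 0 ≤ ε) (hp : 0 ≤ p) (hp' : p ≤ 50) (hy0 : y ≠ 0)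
    (hy : Near ε p |y| y' y) : y' ≠ 0 ∧ Near ε (p + 1) |y|⁻¹ y'⁻¹ y⁻¹ := by
  have hyp : 0 < |y| := abs_pos.2 hy0
  have hpe : p * ε ≤ 1 / 200 := by nlinarith
  have hlow : (1 - p * ε) * |y| ≤ |y'| := by
    have := abs_sub_abs_le_abs_sub y y'
    rw [abs_sub_comm y y'] at this
    linarith [hy.1]
  have hyp' : 0 < |y'| := lt_of_lt_of_le (mul_pos (by linarith) hyp) hlow
  have hy0' : y' ≠ 0 := abs_pos.1 hyp'
  refine ⟨hy0', ?_, (abs_inv y).le⟩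
  have e : y'⁻¹ - y⁻¹ = (y - y') * (y'⁻¹ * y⁻¹) := by field_simp
  rw [e, abs_mul, abs_mul, abs_inv, abs_inv, ← mul_assoc]
  refine mul_le_mul_of_nonneg_right ?_ (by positivity)
  rw [← div_eq_mul_inv, div_le_iff₀ hyp', abs_sub_comm]
  have hbud : p ≤ (p + 1) * (1 - p * ε) := by nlinarith
  calc |y' - y| ≤ p * ε * |y| := hy.1
    _ ≤ ((p + 1) * (1 - p * ε)) * ε * |y| := by gcongr
    _ = (p + 1) * ε * ((1 - p * ε) * |y|) := by ring
    _ ≤ (p + 1) * ε * |y'| := by gcongr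

lemma Near.div (hs : ε ≤ 1 / 10000) {p y' y : ℝ} (x : ℝ) (hp : 0 ≤ p) (hp' : p ≤ 49) (hy0 : y ≠ 0)
    (hy : Near ε p |y| y' y) : Near ε (p + 3) (|x| * |y|⁻¹) (A.div x y') (x / y) := by
  obtain ⟨h0, hi⟩ := hy.inv hs A.nonneg hp (by linarith) hy0
  have hxy : |x / y| ≤ |x| * |y|⁻¹ := by rw [abs_div, div_eq_mul_inv]
  obtain ⟨δ, hδ, e⟩ := A.div_err x y' h0
  refine ⟨?_, hxy⟩
  have h1 := (Near.refl x).mul_exact A.nonneg le_rfl hi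
  rw [← div_eq_mul_inv, ← div_eq_mul_inv] at h1
  rw [e]
  refine near_mul_one_add h1 hxy hδ ?_ (by positivity)
  have := mul_budget A.nonneg hs le_rfl (by norm_num) (by linarith : 0 ≤ p + 1) (by linarith)
  linarith

/-- A sum of squares has no cancellation, so the radicand has relative error `4 ε`. The root does
not amplify it, because `|√s' - √s| √s ≤ |s' - s|`. -/
lemma near_flLength (hs : ε ≤ 1 / 10000) (a b : ℝ) :
    Near ε 6 √(a ^ 2 + b ^ 2) (flLength A a b) √(a ^ 2 + b ^ 2) := by
  have hε := A.nonneg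
  have ha := Near.mul A hs le_rfl (by norm_num) le_rfl (by norm_num) (Near.refl a) (Near.refl a)
  have hb := Near.mul A hs le_rfl (by norm_num) le_rfl (by norm_num) (Near.refl b) (Near.refl b)
  have h := Near.add A hs (by norm_num) ha hb
  rw [abs_mul_abs_self, abs_mul_abs_self, ← sq, ← sq] at h
  unfold flLength
  set s' := A.add (A.mul a a) (A.mul b b)
  set s := a ^ 2 + b ^ 2
  have hs0 : 0 ≤ s := by positivity
  have h1 : |s' - s| ≤ 4 * ε * s := by have := h.1; norm_num at this; exact this
  -- The model promises nothing about roots of negative numbers, so the computed radicand must be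
  -- shown nonnegative.
  have hs0' : 0 ≤ s' := by
    have := (abs_le.1 h1).1
    nlinarith
  obtain ⟨δ, hδ, e⟩ := A.sqrt_err s' hs0'
  have hr := Real.sqrt_nonneg s
  have hr' := Real.sqrt_nonneg s'
  refine ⟨?_, (abs_of_nonneg hr).le⟩
  rw [e]
  refine near_mul_one_add (e := 4 * ε) ?_ (abs_of_nonneg hr).le hδ (by nlinarith) hr
  rcases hr.eq_or_lt with h0 | h0
  · have hsz : s = 0 := (Real.sqrt_eq_zero hs0).1 h0.symm
    rw [hsz] at h1
    have : s' = 0 := by simpa using h1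
    simp [this, hsz]
  · have e2 : s' - s = (√s' - √s) * (√s' + √s) := by
      rw [← Real.sq_sqrt hs0, ← Real.sq_sqrt hs0']; simp; ring
    rw [e2, abs_mul, abs_of_nonneg (by positivity : 0 ≤ √s' + √s)] at h1
    have e3 := Real.mul_self_sqrt hs0
    have h3 : |√s' - √s| * √s ≤ (4 * ε * √s) * √s := by
      calc |√s' - √s| * √s ≤ |√s' - √s| * (√s' + √s) := by gcongr; linarith
        _ ≤ 4 * ε * (√s * √s) := by rwa [e3]
        _ = _ := by ring
    exact le_of_mul_le_mul_right h3 h0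

end RoundingErrors

/-! ### Rounding errors of one QR step -/

section PlaneQR

lemma abs_le_length (x y : ℝ) : |x| ≤ √(x ^ 2 + y ^ 2) ∧ |y| ≤ √(x ^ 2 + y ^ 2) :=
  ⟨Real.abs_le_sqrt (by nlinarith [sq_nonneg y]), Real.abs_le_sqrt (by nlinarith [sq_nonneg x])⟩

lemma abs_add_abs_le_length (u v x y : ℝ) :
    |u| * |x| + |v| * |y| ≤ √(u ^ 2 + v ^ 2) * √(x ^ 2 + y ^ 2) := by
  rw [← Real.sqrt_mul (by positivity)]
  refine Real.le_sqrt_of_sq_le ?_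
  have h1 := sq_abs u
  have h2 := sq_abs v
  have h3 := sq_abs x
  have h4 := sq_abs y
  rw [← h1, ← h2, ← h3, ← h4]
  nlinarith [sq_nonneg (|u| * |y| - |v| * |x|)]

variable {ε : ℝ} (A : FloatArith ε)

/-- Cosine and sine are at most 1 in modulus, so both products have size at most `N`. The count `13
· 2 = 26` would do; 135 is the constant of the reflection. -/
lemma rotation_row_error (hs : ε ≤ 1 / 10000) {a b : ℝ} (hab : ¬(a = 0 ∧ b = 0)) (x y : ℝ) :
    |A.add (A.mul (A.div a (flLength A a b)) x) (A.mul (A.div b (flLength A a b)) y)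
      - (a / √(a ^ 2 + b ^ 2) * x + b / √(a ^ 2 + b ^ 2) * y)| ≤ 135 * ε * √(x ^ 2 + y ^ 2) ∧
    |A.sub (A.mul (A.div a (flLength A a b)) y) (A.mul (A.div b (flLength A a b)) x)
      - (a / √(a ^ 2 + b ^ 2) * y - b / √(a ^ 2 + b ^ 2) * x)| ≤ 135 * ε * √(x ^ 2 + y ^ 2) := by
  have hε := A.nonneg
  have hl := near_flLength A hs a b
  obtain ⟨la, lb⟩ := abs_le_length a b
  obtain ⟨lx, ly⟩ := abs_le_length x y
  have hr : 0 < √(a ^ 2 + b ^ 2) := by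
    refine Real.sqrt_pos.2 ?_
    by_contra h
    exact hab ⟨by nlinarith [sq_nonneg a, sq_nonneg b], by nlinarith [sq_nonneg a, sq_nonneg b]⟩
  set r := √(a ^ 2 + b ^ 2)
  set r' := flLength A a b
  set N := √(x ^ 2 + y ^ 2)
  have hN : 0 ≤ N := Real.sqrt_nonneg _
  have hl' : Near ε 6 |r| r' r := by rwa [abs_of_pos hr]
  have bound : ∀ u v, |u| ≤ r → |v| ≤ N → |u| * |r|⁻¹ * |v| ≤ N := by
    intro u v hu hv
    rw [abs_of_pos hr]
    have : |u| * r⁻¹ ≤ 1 := by rw [← div_eq_mul_inv]; exact div_le_one_of_le₀ hu hr.le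
    calc |u| * r⁻¹ * |v| ≤ 1 * N := by gcongr
      _ = N := one_mul N
  have prod : ∀ u v, |u| ≤ r → |v| ≤ N → Near ε 11 N (A.mul (A.div u r') v) (u / r * v) := by
    intro u v hu hv
    have h := Near.div A hs u (by norm_num) (by norm_num) hr.ne' hl'
    have h2 := Near.mul A hs (by norm_num) (by norm_num) le_rfl (by norm_num) h (Near.refl v)
    exact h2.mono hε (by norm_num) (by norm_num) (bound u v hu hv)
  constructor
  · refine (Near.add A hs (by norm_num) (prod a x la lx) (prod b y lb ly)).1.trans ?_
    nlinarith [mul_nonneg hε hN]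
  · refine (Near.sub A hs (by norm_num) (prod a y la ly) (prod b x lb lx)).1.trans ?_
    nlinarith [mul_nonneg hε hN]

/-- The signed length in the Householder reflection. -/
noncomputable def signedLength (a b : ℝ) : ℝ := if 0 ≤ a then √(a ^ 2 + b ^ 2) else -√(a ^ 2 + b ^ 2)

lemma near_signedLength (hs : ε ≤ 1 / 10000) (a b : ℝ) :
    Near ε 6 √(a ^ 2 + b ^ 2) (if 0 ≤ a then flLength A a b else -flLength A a b)
      (signedLength a b) := by
  have h := near_flLength A hs a b
  unfold signedLength
  split_ifs
  · exact h
  · exact h.neg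

lemma signedLength_sq (a b : ℝ) : signedLength a b ^ 2 = a ^ 2 + b ^ 2 := by
  unfold signedLength
  split_ifs <;> simp [Real.sq_sqrt (by positivity : (0 : ℝ) ≤ a ^ 2 + b ^ 2)]

lemma abs_signedLength (a b : ℝ) : |signedLength a b| = √(a ^ 2 + b ^ 2) := by
  rw [← signedLength_sq, Real.sqrt_sq_eq_abs]

/-- The sign of `σ` is chosen to agree with `a`: no cancellation in `w = a + σ`, which is what makes
the reflection stable. -/
lemma abs_add_signedLength (a b : ℝ) :
    |a + signedLength a b| = |a| + √(a ^ 2 + b ^ 2) := by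
  have hr := Real.sqrt_nonneg (a ^ 2 + b ^ 2)
  unfold signedLength
  split_ifs with h
  · rw [abs_of_nonneg h, abs_of_nonneg (by positivity)]
  · push Not at h
    rw [abs_of_neg h, abs_of_nonpos (by linarith)]
    ring

lemma householder_row_error (hs : ε ≤ 1 / 10000)
    {a b : ℝ} (hab : ¬(a = 0 ∧ b = 0)) (x y : ℝ) {σ' w' β' t' σ w β t : ℝ}
    (hσ' : σ' = if 0 ≤ a then flLength A a b else -flLength A a b) (hw' : w' = A.add a σ')
    (hβ' : β' = A.div 1 (A.mul σ' w')) (ht' : t' = A.mul β' (A.add (A.mul w' x) (A.mul b y)))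
    (hσ : σ = signedLength a b) (hw : w = a + σ) (hβ : β = 1 / (σ * w))
    (ht : t = β * (w * x + b * y)) :
    |A.sub x (A.mul t' w') - (x - t * w)| ≤ 135 * ε * √(x ^ 2 + y ^ 2) ∧
    |A.sub y (A.mul t' b) - (y - t * b)| ≤ 135 * ε * √(x ^ 2 + y ^ 2) := by
  have hε := A.nonneg
  have hr : 0 < √(a ^ 2 + b ^ 2) := by
    refine Real.sqrt_pos.2 ?_
    by_contra h
    exact hab ⟨by nlinarith [sq_nonneg a, sq_nonneg b], by nlinarith [sq_nonneg a, sq_nonneg b]⟩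
  have nσ : Near ε 6 √(a ^ 2 + b ^ 2) σ' σ := by
    rw [hσ', hσ]; exact near_signedLength A hs a b
  have hσabs : |σ| = √(a ^ 2 + b ^ 2) := by rw [hσ]; exact abs_signedLength a b
  have hwabs : |w| = |a| + √(a ^ 2 + b ^ 2) := by rw [hw, hσ]; exact abs_add_signedLength a b
  have hσ2 : σ ^ 2 = a ^ 2 + b ^ 2 := by rw [hσ]; exact signedLength_sq a b
  obtain ⟨lx, ly⟩ := abs_le_length x y
  obtain ⟨lw, lb⟩ := abs_le_length w b
  have hS := abs_add_abs_le_length w b x y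
  have hn : √(w ^ 2 + b ^ 2) * √(w ^ 2 + b ^ 2) = 2 * (|σ| * |w|) := by
    rw [Real.mul_self_sqrt (by positivity), ← abs_mul]
    have e : w ^ 2 + b ^ 2 = 2 * (σ * w) := by rw [hw]; linear_combination -hσ2
    rw [e, abs_of_nonneg (by nlinarith [sq_nonneg w, sq_nonneg b])]
  have hN : 0 ≤ √(x ^ 2 + y ^ 2) := Real.sqrt_nonneg _
  set r := √(a ^ 2 + b ^ 2)
  set N := √(x ^ 2 + y ^ 2)
  set n := √(w ^ 2 + b ^ 2)
  have hn0 : 0 ≤ n := Real.sqrt_nonneg _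
  have hwpos : 0 < |w| := by rw [hwabs]; positivity
  have hσpos : 0 < |σ| := by rw [hσabs]; exact hr
  have nw : Near ε 8 |w| w' w := by
    rw [hwabs, hw', hw]
    have := Near.add A hs (by norm_num) ((Near.refl a).mono hε (by norm_num) (by norm_num) le_rfl) nσ
    exact this.mono hε (by norm_num) (by norm_num) le_rfl
  have nσw : Near ε 16 |σ * w| (A.mul σ' w') (σ * w) := by
    rw [abs_mul, hσabs]
    have := Near.mul A hs (by norm_num) (by norm_num) (by norm_num) (by norm_num) nσ nw
    exact this.mono hε (by norm_num) (by norm_num) le_rfl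
  have hσw0 : σ * w ≠ 0 := mul_ne_zero (abs_pos.1 hσpos) (abs_pos.1 hwpos)
  have nβ : Near ε 19 (|σ| * |w|)⁻¹ β' β := by
    rw [hβ', hβ]
    have := Near.div A hs 1 (by norm_num) (by norm_num) hσw0 nσw
    refine this.mono hε (by norm_num) (by norm_num) ?_
    rw [abs_one, one_mul, abs_mul]
  have nwx : Near ε 10 (|w| * |x|) (A.mul w' x) (w * x) :=
    (Near.mul A hs (by norm_num) (by norm_num) le_rfl (by norm_num) nw (Near.refl x)).mono hε
      (by norm_num) (by norm_num) le_rfl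
  have nby : Near ε 10 (|b| * |y|) (A.mul b y) (b * y) :=
    (Near.mul A hs le_rfl (by norm_num) le_rfl (by norm_num) (Near.refl b) (Near.refl y)).mono hε
      (by norm_num) (by norm_num) le_rfl
  have nS : Near ε 12 (n * N) (A.add (A.mul w' x) (A.mul b y)) (w * x + b * y) :=
    (Near.add A hs (by norm_num) nwx nby).mono hε (by norm_num) (by norm_num) hS
  have nt : Near ε 33 ((|σ| * |w|)⁻¹ * (n * N)) t' t := by
    rw [ht', ht]
    exact (Near.mul A hs (by norm_num) (by norm_num) (by norm_num) (by norm_num) nβ nS).mono hε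
      (by norm_num) (by norm_num) le_rfl
  -- The identity `n² = w² + b² = 2 σ w` cancels `β`, so the correction has size at most `2 N`
  -- however small the pivot row is.
  have hsize : ∀ z, z ≤ n → (|σ| * |w|)⁻¹ * (n * N) * z ≤ 2 * N := by
    intro z hz
    have hp : 0 < |σ| * |w| := by positivity
    calc (|σ| * |w|)⁻¹ * (n * N) * z ≤ (|σ| * |w|)⁻¹ * (n * N) * n := by gcongr
      _ = (|σ| * |w|)⁻¹ * (n * n) * N := by ring
      _ = 2 * N := by rw [hn]; field_simp
  have ntw : Near ε 43 (2 * N) (A.mul t' w') (t * w) :=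
    (Near.mul A hs (by norm_num) (by norm_num) (by norm_num) (by norm_num) nt nw).mono hε
      (by norm_num) (by norm_num) (hsize _ lw)
  have ntb : Near ε 43 (2 * N) (A.mul t' b) (t * b) :=
    (Near.mul A hs (by norm_num) (by norm_num) le_rfl (by norm_num) nt (Near.refl b)).mono hε
      (by norm_num) (by norm_num) (hsize _ lb)
  -- The constant is `45 · 3 = 135`: error count `43 + 2`, sizes `N + 2 N`.
  constructor
  · refine (Near.sub A hs (by norm_num)
      ((Near.refl x).mono hε (by norm_num) (by norm_num) lx) ntw).1.trans ?_
    nlinarith [mul_nonneg hε hN]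
  · refine (Near.sub A hs (by norm_num)
      ((Near.refl y).mono hε (by norm_num) (by norm_num) ly) ntb).1.trans ?_
    nlinarith [mul_nonneg hε hN]

variable {d : ℕ}

lemma mul_transpose_eq_of_rows {R G : Matrix (Fin (d + 1)) (Fin 2) ℝ}
    (h : ∀ i j, R i 0 * R j 0 + R i 1 * R j 1 = G i 0 * G j 0 + G i 1 * G j 1) :
    R * Rᵀ = G * Gᵀ := by
  ext i j
  simpa [Matrix.mul_apply, Fin.sum_univ_two] using h i j

lemma exists_near_rotationQR (hs : ε ≤ 1 / 10000) (k : Fin (d + 1)) (G : Matrix (Fin (d + 1)) (Fin 2) ℝ)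
    (hk : ¬(G k 0 = 0 ∧ G k 1 = 0)) :
    ∃ R : Matrix (Fin (d + 1)) (Fin 2) ℝ, R * Rᵀ = G * Gᵀ ∧
      ∀ i j, |rotationQR A k G i j - R i j| ≤ 135 * ε * √(G i 0 ^ 2 + G i 1 ^ 2) := by
  have hε := A.nonneg
  have hpos : 0 < G k 0 ^ 2 + G k 1 ^ 2 := by
    by_contra h
    exact hk ⟨by nlinarith [sq_nonneg (G k 0), sq_nonneg (G k 1)],
      by nlinarith [sq_nonneg (G k 0), sq_nonneg (G k 1)]⟩
  have hr := Real.sqrt_pos.2 hpos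
  have hr2 := Real.sq_sqrt hpos.le
  have hrow := rotation_row_error A hs hk
  have hlen := near_flLength A hs (G k 0) (G k 1)
  set r := √(G k 0 ^ 2 + G k 1 ^ 2) with hrdef
  refine ⟨Matrix.of fun i => ![G k 0 / r * G i 0 + G k 1 / r * G i 1,
    G k 0 / r * G i 1 - G k 1 / r * G i 0], mul_transpose_eq_of_rows fun i j => ?_, fun i j => ?_⟩
  · simp only [of_apply, cons_val_zero, cons_val_one]
    have h1 : (G k 0 / r) ^ 2 + (G k 1 / r) ^ 2 = 1 := by
      rw [div_pow, div_pow, ← add_div, hr2, div_self hpos.ne']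
    linear_combination (G i 0 * G j 0 + G i 1 * G j 1) * h1
  · by_cases hik : i = k
    · subst hik
      have e0 : G i 0 / r * G i 0 + G i 1 / r * G i 1 = r := by
        field_simp; linarith
      have e1 : G i 0 / r * G i 1 - G i 1 / r * G i 0 = 0 := by ring
      fin_cases j
      · simp only [rotationQR, of_apply, if_true, Fin.zero_eta, cons_val_zero, e0]
        exact (hlen.mono hε (by norm_num) (by norm_num) le_rfl).1
      · simp only [rotationQR, of_apply, if_true, Fin.mk_one, cons_val_one, cons_val_fin_one, e1]
        rw [sub_zero, abs_zero]
        positivity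
    · fin_cases j
      · simp only [rotationQR, of_apply, if_neg hik, Fin.zero_eta, cons_val_zero]
        exact (hrow (G i 0) (G i 1)).1
      · simp only [rotationQR, of_apply, if_neg hik, Fin.mk_one, cons_val_one]
        exact (hrow (G i 0) (G i 1)).2

lemma exists_near_householderQR (hs : ε ≤ 1 / 10000) (k : Fin (d + 1)) (G : Matrix (Fin (d + 1)) (Fin 2) ℝ)
    (hk : ¬(G k 0 = 0 ∧ G k 1 = 0)) :
    ∃ R : Matrix (Fin (d + 1)) (Fin 2) ℝ, R * Rᵀ = G * Gᵀ ∧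
      ∀ i j, |householderQR A k G i j - R i j| ≤ 135 * ε * √(G i 0 ^ 2 + G i 1 ^ 2) := by
  have hε := A.nonneg
  have hpos : 0 < G k 0 ^ 2 + G k 1 ^ 2 := by
    by_contra h
    exact hk ⟨by nlinarith [sq_nonneg (G k 0), sq_nonneg (G k 1)],
      by nlinarith [sq_nonneg (G k 0), sq_nonneg (G k 1)]⟩
  have hlen := near_signedLength A hs (G k 0) (G k 1)
  have hσ2 := signedLength_sq (G k 0) (G k 1)
  have hwabs := abs_add_signedLength (G k 0) (G k 1)
  set a := G k 0 with ha
  set b := G k 1 with hb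
  set σ := signedLength a b with hσ
  set w := a + σ with hw
  set β := 1 / (σ * w) with hβ
  have hσ0 : σ ≠ 0 := by
    intro h; rw [h] at hσ2; norm_num at hσ2; linarith
  have hw0 : w ≠ 0 := by
    rw [← abs_pos, hwabs]
    have := Real.sqrt_pos.2 hpos
    positivity
  have hβ1 : β * (σ * w) = 1 := one_div_mul_cancel (mul_ne_zero hσ0 hw0)
  have hww : w ^ 2 + b ^ 2 = 2 * (σ * w) := by rw [hw]; linear_combination -hσ2
  refine ⟨Matrix.of fun i => ![G i 0 - β * (w * G i 0 + b * G i 1) * w,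
    G i 1 - β * (w * G i 0 + b * G i 1) * b], mul_transpose_eq_of_rows fun i j => ?_,
    fun i j => ?_⟩
  -- Orthogonality of the reflection is `β (w² + b²) = 2`, used here through its two halves `hww`
  -- and `hβ1`.
  · simp only [of_apply, cons_val_zero, cons_val_one]
    linear_combination (β ^ 2 * (w * G i 0 + b * G i 1) * (w * G j 0 + b * G j 1)) * hww
      + 2 * β * (w * G i 0 + b * G i 1) * (w * G j 0 + b * G j 1) * hβ1
  · by_cases hik : i = k
    · subst hik
      have et : β * (w * a + b * b) = 1 := by
        rw [← hβ1, hw]; linear_combination -β * hσ2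
      have e0 : G i 0 - β * (w * G i 0 + b * G i 1) * w = -σ := by
        rw [← ha, ← hb, et, hw]; ring
      have e1 : G i 1 - β * (w * G i 0 + b * G i 1) * b = 0 := by
        rw [← ha, ← hb, et]; ring
      fin_cases j
      · simp only [householderQR, of_apply, if_true, Fin.zero_eta, cons_val_zero, e0]
        exact (hlen.neg.mono hε (by norm_num) (by norm_num) le_rfl).1
      · simp only [householderQR, of_apply, if_true, Fin.mk_one, cons_val_one, cons_val_fin_one, e1]
        rw [sub_zero, abs_zero]
        positivity
    · have hrow := householder_row_error A hs hk (G i 0) (G i 1) rfl rfl rfl rfl hσ hw hβ rfl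
      fin_cases j
      · simp only [householderQR, of_apply, if_neg hik, Fin.zero_eta, cons_val_zero]
        exact hrow.1
      · simp only [householderQR, of_apply, if_neg hik, Fin.mk_one, cons_val_one]
        exact hrow.2

/-- The comparison matrix comes from the same formulas in exact arithmetic. Its pivot row agrees
with the one that the algorithm assigns directly, up to the error of the length. -/
lemma exists_near_qrFactor (hs : ε ≤ 1 / 10000) (k : Fin (d + 1)) (G : Matrix (Fin (d + 1)) (Fin 2) ℝ)
    (m : QRMethod) :
    ∃ R : Matrix (Fin (d + 1)) (Fin 2) ℝ, R * Rᵀ = G * Gᵀ ∧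
      ∀ i j, |qrFactor A m k G i j - R i j| ≤ 135 * ε * √(G i 0 ^ 2 + G i 1 ^ 2) := by
  have hε := A.nonneg
  by_cases hk : G k 0 = 0 ∧ G k 1 = 0
  · refine ⟨G, rfl, fun i j => ?_⟩
    simp only [qrFactor, if_pos hk, sub_self, abs_zero]
    positivity
  · simp only [qrFactor, if_neg hk]
    cases m
    · exact exists_near_rotationQR A hs k G hk
    · exact exists_near_householderQR A hs k G hk

lemma qrFactor_error (hs : ε ≤ 1 / 10000) (k : Fin (d + 1)) (G : Matrix (Fin (d + 1)) (Fin 2) ℝ)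
    (m : QRMethod) :
    ‖qrFactor A m k G * (qrFactor A m k G)ᵀ - G * Gᵀ‖ ≤ 500 * ε * ‖G‖ ^ 2 ∧
      ‖qrFactor A m k G‖ ≤ (1 + 200 * ε) * ‖G‖ := by
  have hε := A.nonneg
  obtain ⟨R, hR, hE⟩ := exists_near_qrFactor A hs k G m
  have hn : ‖R‖ = ‖G‖ := frobenius_eq_of_mul_transpose_eq hR
  -- Two entries per row: `135 √2 < 200`.
  have hdiff : ‖qrFactor A m k G - R‖ ≤ 200 * ε * ‖G‖ := by
    rw [← sq_le_sq₀ (norm_nonneg _) (by positivity), mul_pow, frobenius_sq, frobenius_sq,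
      Finset.mul_sum]
    refine Finset.sum_le_sum fun i _ => ?_
    rw [Fin.sum_univ_two, Fin.sum_univ_two]
    have hsq := Real.sq_sqrt (by positivity : 0 ≤ G i 0 ^ 2 + G i 1 ^ 2)
    have h : ∀ j, (qrFactor A m k G - R) i j ^ 2 ≤ (135 * ε) ^ 2 * (G i 0 ^ 2 + G i 1 ^ 2) := by
      intro j
      rw [← hsq, ← mul_pow]
      exact sq_le_sq' (abs_le.1 (hE i j)).1 (abs_le.1 (hE i j)).2
    have h0 := h 0
    have h1 := h 1
    have : 0 ≤ ε ^ 2 * (G i 0 ^ 2 + G i 1 ^ 2) := by positivity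
    nlinarith
  have hG := norm_nonneg G
  constructor
  · rw [← hR]
    refine (norm_mul_transpose_sub_le _ _).trans ?_
    rw [hn]
    calc ‖qrFactor A m k G - R‖ * (‖qrFactor A m k G - R‖ + 2 * ‖G‖)
        ≤ (200 * ε * ‖G‖) * (200 * ε * ‖G‖ + 2 * ‖G‖) := by gcongr
      _ = (200 * (200 * ε + 2)) * ε * ‖G‖ ^ 2 := by ring
      _ ≤ 500 * ε * ‖G‖ ^ 2 := by gcongr; linarith
  · have := norm_add_le (qrFactor A m k G - R) R
    rw [sub_add_cancel, hn] at this
    linarith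

end PlaneQR

/-! ### Exact zeros, telescoping and the backward error -/

section BackwardError

variable {ε : ℝ} (A : FloatArith ε) (m : QRMethod) {d : ℕ}

lemma FloatArith.mul_zero' (x : ℝ) : A.mul x 0 = 0 := by
  obtain ⟨δ, -, e⟩ := A.mul_err x 0
  simpa using e

lemma FloatArith.zero_mul' (x : ℝ) : A.mul 0 x = 0 := by
  obtain ⟨δ, -, e⟩ := A.mul_err 0 x
  simpa using e

lemma FloatArith.zero_add_zero : A.add 0 0 = 0 := by
  obtain ⟨δ, -, e⟩ := A.add_err 0 0
  simpa using e

lemma FloatArith.zero_sub_zero : A.sub 0 0 = 0 := by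
  obtain ⟨δ, -, e⟩ := A.sub_err 0 0
  simpa using e

/-- Purely relative errors leave operations with exact result zero exact, so zero rows survive
rounding. -/
lemma qrFactor_zero_row {k i : Fin (d + 1)} {G : Matrix (Fin (d + 1)) (Fin 2) ℝ}
    (h : ∀ j, G i j = 0) (j : Fin 2) : qrFactor A m k G i j = 0 := by
  by_cases hk : G k 0 = 0 ∧ G k 1 = 0
  · simp only [qrFactor, if_pos hk, h]
  · have hik : i ≠ k := by
      rintro rfl
      exact hk ⟨h 0, h 1⟩
    cases m <;> fin_cases j <;>
      simp [qrFactor, if_neg hk, rotationQR, householderQR, hik, h, A.mul_zero', A.zero_mul',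
        A.zero_add_zero, A.zero_sub_zero]

lemma qrFactor_pivot (k : Fin (d + 1)) (G : Matrix (Fin (d + 1)) (Fin 2) ℝ) :
    qrFactor A m k G k 1 = 0 := by
  by_cases hk : G k 0 = 0 ∧ G k 1 = 0
  · simp only [qrFactor, if_pos hk]
    exact hk.2
  · cases m <;> simp [qrFactor, if_neg hk, rotationQR, householderQR]

/-- Each pass clears one more row: the shift pushes the first column down by one, and the second
column is zero in the pivot row. -/
lemma nextGenerator_zero_row {k : Fin (d + 1)} {G : Matrix (Fin (d + 1)) (Fin 2) ℝ}
    (h : ∀ i < k, ∀ j, G i j = 0) (i : Fin (d + 1)) (hi : i ≤ k) (j : Fin 2) :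
    nextGenerator A m k G i j = 0 := by
  fin_cases j
  · simp only [nextGenerator, of_apply, Fin.zero_eta, cons_val_zero, lowerShift_mulVec]
    induction i using Fin.cases with
    | zero => rfl
    | succ i =>
      exact qrFactor_zero_row A m (h _ (lt_of_lt_of_le i.castSucc_lt_succ hi)) 0
  · simp only [nextGenerator, of_apply, Fin.mk_one, cons_val_one, cons_val_fin_one]
    rcases hi.eq_or_lt with rfl | hi
    · exact qrFactor_pivot A m i G
    · exact qrFactor_zero_row A m (h i hi) 1

lemma generator_zero_row (G : Matrix (Fin (d + 1)) (Fin 2) ℝ) {n : ℕ} (hn : n ≤ d + 1)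
    (i : Fin (d + 1)) (hi : (i : ℕ) < n) (j : Fin 2) : generator A m G n i j = 0 := by
  induction n generalizing i j with
  | zero => omega
  | succ n ih =>
    have hval : ((Fin.ofNat (d + 1) n : Fin (d + 1)) : ℕ) = n := Nat.mod_eq_of_lt (by omega)
    refine nextGenerator_zero_row A m (fun i hi j => ih (by omega) i ?_ j) i ?_ j
    · rw [Fin.lt_def, hval] at hi
      exact hi
    · rw [Fin.le_def, hval]
      omega

lemma generator_last (G : Matrix (Fin (d + 1)) (Fin 2) ℝ) : generator A m G (d + 1) = 0 := by
  ext i j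
  exact generator_zero_row A m G le_rfl i i.isLt j

lemma computedU_lowerTriangular (G : Matrix (Fin (d + 1)) (Fin 2) ℝ) {i k : Fin (d + 1)}
    (h : i < k) : computedU A m G i k = 0 :=
  qrFactor_zero_row A m (generator_zero_row A m G (by omega) i h) 0

/-- The computed factor `R̂_n`. -/
noncomputable def computedR (G : Matrix (Fin (d + 1)) (Fin 2) ℝ) (n : ℕ) :
    Matrix (Fin (d + 1)) (Fin 2) ℝ :=
  qrFactor A m (Fin.ofNat (d + 1) n) (generator A m G n)

lemma computedU_eq (G : Matrix (Fin (d + 1)) (Fin 2) ℝ) (i k : Fin (d + 1)) :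
    computedU A m G i k = computedR A m G k i 0 := by
  have : Fin.ofNat (d + 1) (k : ℕ) = k := Fin.ext (Nat.mod_eq_of_lt k.isLt)
  rw [computedR, this]
  rfl

lemma norm_nextGenerator_le (k : Fin (d + 1)) (G : Matrix (Fin (d + 1)) (Fin 2) ℝ) :
    ‖nextGenerator A m k G‖ ≤ ‖qrFactor A m k G‖ := by
  rw [← sq_le_sq₀ (norm_nonneg _) (norm_nonneg _), frobenius_sq, frobenius_sq]
  simp only [Fin.sum_univ_two, Finset.sum_add_distrib, nextGenerator, of_apply, cons_val_zero,
    cons_val_one, cons_val_fin_one]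
  have := lowerShift_spectralSqLe fun j => qrFactor A m k G j 0
  simp only [dotProduct, ← sq, one_mul] at this
  linarith

lemma norm_generator_le (hs : ε ≤ 1 / 10000) (G : Matrix (Fin (d + 1)) (Fin 2) ℝ) (n : ℕ) :
    ‖generator A m G n‖ ≤ (1 + 200 * ε) ^ n * ‖G‖ := by
  have hε := A.nonneg
  induction n with
  | zero => simp [generator]
  | succ n ih =>
    calc ‖generator A m G (n + 1)‖ ≤ ‖computedR A m G n‖ := norm_nextGenerator_le A m _ _
      _ ≤ (1 + 200 * ε) * ‖generator A m G n‖ := (qrFactor_error A hs _ _ m).2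
      _ ≤ (1 + 200 * ε) * ((1 + 200 * ε) ^ n * ‖G‖) := by gcongr
      _ = _ := by ring

lemma norm_computedR_le (hs : ε ≤ 1 / 10000) (G : Matrix (Fin (d + 1)) (Fin 2) ℝ) (n : ℕ) :
    ‖computedR A m G n‖ ≤ (1 + 200 * ε) ^ (n + 1) * ‖G‖ := by
  have hε := A.nonneg
  calc ‖computedR A m G n‖ ≤ (1 + 200 * ε) * ‖generator A m G n‖ := (qrFactor_error A hs _ _ m).2
    _ ≤ (1 + 200 * ε) * ((1 + 200 * ε) ^ n * ‖G‖) := by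
      gcongr
      exact norm_generator_le A m hs G n
    _ = _ := by ring

lemma growth_sq_le (hε : 0 ≤ ε) (hd : 1 ≤ d) (hde : (d : ℝ) * ε ≤ 1 / 10000) {n : ℕ}
    (hn : n ≤ d + 1) : ((1 + 200 * ε) ^ n) ^ 2 ≤ 2 := by
  have hd' : (1 : ℝ) ≤ d := by exact_mod_cast hd
  have hn' : (n : ℝ) ≤ d + 1 := by exact_mod_cast hn
  have h1 : (1 + 200 * ε) ^ n ≤ Real.exp (n * (200 * ε)) := by
    rw [Real.exp_nat_mul]
    gcongr
    rw [add_comm]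
    exact Real.add_one_le_exp _
  -- Here `n ≤ d + 1 ≤ 2 d`, so the product is at most `400 d ε ≤ 1/25`.
  have h2 : n * (200 * ε) ≤ 1 / 25 := by nlinarith
  calc ((1 + 200 * ε) ^ n) ^ 2 ≤ (Real.exp (1 / 25)) ^ 2 := by
        gcongr
        exact h1.trans (Real.exp_le_exp.2 h2)
    _ = Real.exp (2 / 25) := by rw [← Real.exp_nat_mul]; norm_num
    _ ≤ Real.exp (Real.log 2) := by
      apply Real.exp_le_exp.2
      linarith [Real.log_two_gt_d9]
    _ = 2 := Real.exp_log (by norm_num)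

/-- A Gram matrix `R Rᵀ` is the sum of the outer products of its columns, and only the first column
is shifted. No rounding enters. -/
lemma step_identity (G : Matrix (Fin (d + 1)) (Fin 2) ℝ) (n : ℕ) :
    let u := fun i => computedR A m G n i 0
    generator A m G (n + 1) * (generator A m G (n + 1))ᵀ
      = computedR A m G n * (computedR A m G n)ᵀ - vecMulVec u u
        + lowerShift d * vecMulVec u u * (lowerShift d)ᵀ := by
  intro u
  rw [mul_vecMulVec, vecMulVec_mul, vecMul_transpose]
  ext i j
  simp only [generator, nextGenerator, Matrix.mul_apply, Fin.sum_univ_two, transpose_apply,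
    of_apply, cons_val_zero, cons_val_one, cons_val_fin_one, Matrix.add_apply, Matrix.sub_apply,
    vecMulVec_apply]
  simp only [u, computedR]
  ring

lemma computedU_mul_transpose (G : Matrix (Fin (d + 1)) (Fin 2) ℝ) :
    computedU A m G * (computedU A m G)ᵀ = ∑ n ∈ Finset.range (d + 1),
      vecMulVec (fun i => computedR A m G n i 0) (fun i => computedR A m G n i 0) := by
  rw [Finset.sum_range]
  ext i j
  simp only [Matrix.mul_apply, transpose_apply, computedU_eq, Matrix.sum_apply, vecMulVec_apply]

/-- The residual `K - Û Ûᵀ` has a displacement that is the sum of the local errors. -/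
lemma displacement_residual {K : Matrix (Fin (d + 1)) (Fin (d + 1)) ℝ}
    {G : Matrix (Fin (d + 1)) (Fin 2) ℝ}
    (hK : K - lowerShift d * K * (lowerShift d)ᵀ = G * Gᵀ) :
    let X := K - computedU A m G * (computedU A m G)ᵀ
    X - lowerShift d * X * (lowerShift d)ᵀ = ∑ n ∈ Finset.range (d + 1),
      (generator A m G n * (generator A m G n)ᵀ - computedR A m G n * (computedR A m G n)ᵀ) := by
  intro X
  have tel := Finset.sum_range_sub' (fun n => generator A m G n * (generator A m G n)ᵀ) (d + 1)
  rw [generator_last] at tel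
  simp only [Matrix.zero_mul, sub_zero, generator] at tel
  have hX : X - lowerShift d * X * (lowerShift d)ᵀ
      = G * Gᵀ - (computedU A m G * (computedU A m G)ᵀ
        - lowerShift d * (computedU A m G * (computedU A m G)ᵀ) * (lowerShift d)ᵀ) := by
    rw [← hK]
    simp only [X, Matrix.mul_sub, Matrix.sub_mul]
    abel
  rw [hX, computedU_mul_transpose, Matrix.mul_sum, Matrix.sum_mul, ← tel,
    ← Finset.sum_sub_distrib, ← Finset.sum_sub_distrib]
  refine Finset.sum_congr rfl fun n _ => ?_
  have h := step_identity A m G n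
  simp only [generator] at h
  rw [h]
  abel

lemma precision_le (hd : 1 ≤ d) (hde : (d : ℝ) * ε ≤ 1 / 10000) : ε ≤ 1 / 10000 := by
  have hd' : (1 : ℝ) ≤ d := by exact_mod_cast hd
  by_contra h
  push Not at h
  nlinarith

/-- One factor `d + 1 ≤ 2 d` counts the local errors, the other inverts the displacement operator;
each local error is at most `500 · 2 ε ‖G‖²`. -/
lemma computedU_backward_error (hd : 1 ≤ d) (hde : (d : ℝ) * ε ≤ 1 / 10000)
    {K : Matrix (Fin (d + 1)) (Fin (d + 1)) ℝ}
    {G : Matrix (Fin (d + 1)) (Fin 2) ℝ}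
    (hK : K - lowerShift d * K * (lowerShift d)ᵀ = G * Gᵀ) :
    ‖computedU A m G * (computedU A m G)ᵀ - K‖ ≤ 4000 * (d : ℝ) ^ 2 * ‖G‖ ^ 2 * ε := by
  have hε := A.nonneg
  have hd' : (1 : ℝ) ≤ d := by exact_mod_cast hd
  have hs := precision_le hd hde
  rw [norm_sub_rev]
  refine (norm_le_of_displacement (displacement_residual A m hK)).trans ?_
  have hsum : ‖∑ n ∈ Finset.range (d + 1), (generator A m G n * (generator A m G n)ᵀ
      - computedR A m G n * (computedR A m G n)ᵀ)‖ ≤ (d + 1) * (1000 * ε * ‖G‖ ^ 2) := by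
    refine (norm_sum_le_of_le (f := fun n => generator A m G n * (generator A m G n)ᵀ
      - computedR A m G n * (computedR A m G n)ᵀ) (Finset.range (d + 1))
      (n := fun _ => 1000 * ε * ‖G‖ ^ 2) fun n hn => ?_).trans ?_
    · rw [norm_sub_rev]
      refine (qrFactor_error A hs _ _ m).1.trans ?_
      have h1 := norm_generator_le A m hs G n
      have h2 := growth_sq_le hε hd hde (Finset.mem_range.1 hn).le
      calc 500 * ε * ‖generator A m G n‖ ^ 2 ≤ 500 * ε * ((1 + 200 * ε) ^ n * ‖G‖) ^ 2 := by gcongr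
        _ = 500 * ε * (((1 + 200 * ε) ^ n) ^ 2 * ‖G‖ ^ 2) := by ring
        _ ≤ 500 * ε * (2 * ‖G‖ ^ 2) := by gcongr
        _ = _ := by ring
    · simp
  calc ((d : ℝ) + 1) * _ ≤ ((d : ℝ) + 1) * ((d + 1) * (1000 * ε * ‖G‖ ^ 2)) := by gcongr
    _ ≤ ((d : ℝ) + d) * ((d + d) * (1000 * ε * ‖G‖ ^ 2)) := by gcongr
    _ = _ := by ring

lemma norm_computedU_sq_le (hd : 1 ≤ d) (hde : (d : ℝ) * ε ≤ 1 / 10000)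
    (G : Matrix (Fin (d + 1)) (Fin 2) ℝ) :
    ‖computedU A m G‖ ^ 2 ≤ 4 * d * ‖G‖ ^ 2 := by
  have hε := A.nonneg
  have hd' : (1 : ℝ) ≤ d := by exact_mod_cast hd
  have hs := precision_le hd hde
  rw [frobenius_sq, Finset.sum_comm]
  have h : ∀ k ∈ Finset.univ, ∑ i, computedU A m G i k ^ 2 ≤ 2 * ‖G‖ ^ 2 := by
    intro k _
    have h1 := norm_computedR_le A m hs G k
    have h2 := growth_sq_le (n := (k : ℕ) + 1) hε hd hde k.isLt
    calc ∑ i, computedU A m G i k ^ 2 ≤ ‖computedR A m G k‖ ^ 2 := by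
          rw [frobenius_sq]
          refine Finset.sum_le_sum fun i _ => ?_
          rw [Fin.sum_univ_two, computedU_eq]
          nlinarith [sq_nonneg (computedR A m G k i 1)]
      _ ≤ ((1 + 200 * ε) ^ ((k : ℕ) + 1) * ‖G‖) ^ 2 := by gcongr
      _ = ((1 + 200 * ε) ^ ((k : ℕ) + 1)) ^ 2 * ‖G‖ ^ 2 := by ring
      _ ≤ 2 * ‖G‖ ^ 2 := by gcongr
  refine (Finset.sum_le_sum h).trans ?_
  simp only [Finset.sum_const, Finset.card_univ, Fintype.card_fin, nsmul_eq_mul]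
  push_cast
  nlinarith [sq_nonneg ‖G‖]

lemma computedL_error {G : Matrix (Fin (d + 1)) (Fin 2) ℝ} (hG : NoBreakdown A m G) :
    ‖computedL A m G - Matrix.of fun i k => computedU A m G i k / computedU A m G k k‖
      ≤ ε * ‖Matrix.of fun i k => computedU A m G i k / computedU A m G k k‖ := by
  refine frobenius_le_of_entry A.nonneg fun i k => ?_
  obtain ⟨δ, hδ, e⟩ := A.div_err (computedU A m G i k) _ (hG k)
  rw [Matrix.sub_apply, computedL, of_apply, of_apply, e,
    show ∀ x : ℝ, x * (1 + δ) - x = δ * x by intro x; ring, abs_mul]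
  gcongr

/-- Multiplying by `Ĥ` undoes the division by the pivots, so `L̂ Ĥ` is `Û` up to entrywise relative
error `ε`. The argument gives order `d²`, which is then relaxed to `d³`. -/
lemma backward_error (hd : 1 ≤ d) (hde : (d : ℝ) * ε ≤ 1 / 10000)
    {K : Matrix (Fin (d + 1)) (Fin (d + 1)) ℝ}
    {G : Matrix (Fin (d + 1)) (Fin 2) ℝ}
    (hK : K - lowerShift d * K * (lowerShift d)ᵀ = G * Gᵀ) (hG : NoBreakdown A m G) :
    ‖computedL A m G * computedH A m G ^ 2 * (computedL A m G)ᵀ - K‖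
      ≤ 5000 * (d : ℝ) ^ 3 * ‖G‖ ^ 2 * ε := by
  have hε := A.nonneg
  have hd' : (1 : ℝ) ≤ d := by exact_mod_cast hd
  have hs := precision_le hd hde
  have hU := computedU_backward_error A m hd hde hK
  have hUn := norm_computedU_sq_le A m hd hde G
  have hLH : ‖computedL A m G * computedH A m G - computedU A m G‖ ≤ ε * ‖computedU A m G‖ := by
    refine frobenius_le_of_entry hε fun i k => ?_
    obtain ⟨δ, hδ, e⟩ := A.div_err (computedU A m G i k) _ (hG k)
    rw [Matrix.sub_apply, computedH, mul_diagonal, computedL, of_apply, e]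
    have h0 := hG k
    have : computedU A m G i k / computedU A m G k k * (1 + δ) * computedU A m G k k
        - computedU A m G i k = δ * computedU A m G i k := by
      field_simp
      ring
    rw [this, abs_mul]
    gcongr
  have hprod : computedL A m G * computedH A m G ^ 2 * (computedL A m G)ᵀ
      = (computedL A m G * computedH A m G) * (computedL A m G * computedH A m G)ᵀ := by
    have : (computedH A m G)ᵀ = computedH A m G := diagonal_transpose _
    rw [transpose_mul, this, sq]
    simp only [Matrix.mul_assoc]
  have h1 : ‖computedL A m G * computedH A m G ^ 2 * (computedL A m G)ᵀ
      - computedU A m G * (computedU A m G)ᵀ‖ ≤ 12 * d * ‖G‖ ^ 2 * ε := by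
    rw [hprod]
    refine (norm_mul_transpose_sub_le _ _).trans ?_
    have hn := norm_nonneg (computedU A m G)
    calc _ ≤ (ε * ‖computedU A m G‖) * (ε * ‖computedU A m G‖ + 2 * ‖computedU A m G‖) := by gcongr
      _ = ε * (ε + 2) * ‖computedU A m G‖ ^ 2 := by ring
      _ ≤ ε * 3 * (4 * d * ‖G‖ ^ 2) := by gcongr; linarith
      _ = _ := by ring
  have h2 := norm_add_le (computedL A m G * computedH A m G ^ 2 * (computedL A m G)ᵀ
      - computedU A m G * (computedU A m G)ᵀ) (computedU A m G * (computedU A m G)ᵀ - K)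
  rw [sub_add_sub_cancel] at h2
  refine h2.trans ((add_le_add h1 hU).trans ?_)
  have hd2 : (d : ℝ) ^ 2 ≤ (d : ℝ) ^ 3 := pow_le_pow_right₀ hd' (by norm_num)
  have hd1 : (d : ℝ) ≤ (d : ℝ) ^ 3 := le_self_pow₀ hd' (by norm_num)
  have hg : 0 ≤ ‖G‖ ^ 2 * ε := by positivity
  nlinarith [mul_le_mul_of_nonneg_right hd2 hg, mul_le_mul_of_nonneg_right hd1 hg]

end BackwardError

/-! ### Triangular factors and their perturbation identity -/

section LowerTriangular

variable {n : Type*} [Fintype n] [LinearOrder n]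

lemma lowerTriangular_mul {A B : Matrix n n ℝ} (hA : ∀ i j, i < j → A i j = 0)
    (hB : ∀ i j, i < j → B i j = 0) (i j : n) (hij : i < j) : (A * B) i j = 0 := by
  rw [Matrix.mul_apply]
  refine Finset.sum_eq_zero fun k _ => ?_
  rcases lt_or_ge i k with h | h
  · rw [hA i k h, zero_mul]
  · rw [hB k j (h.trans_lt hij), mul_zero]

lemma lowerTriangular_mul_diag {A B : Matrix n n ℝ} (hA : ∀ i j, i < j → A i j = 0)
    (hB : ∀ i j, i < j → B i j = 0) (k : n) : (A * B) k k = A k k * B k k := by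
  rw [Matrix.mul_apply]
  refine Finset.sum_eq_single k (fun j _ hj => ?_) (by simp)
  rcases lt_or_gt_of_ne hj with h | h
  · rw [hB j k h, mul_zero]
  · rw [hA k j h, zero_mul]

lemma lowerTriangular_inv {A : Matrix n n ℝ} (hA : ∀ i j, i < j → A i j = 0)
    (hu : IsUnit A.det) (i j : n) (hij : i < j) : A⁻¹ i j = 0 := by
  have : Invertible A := A.invertibleOfIsUnitDet hu
  have hb : BlockTriangular A OrderDual.toDual := fun i j h => hA i j h
  exact blockTriangular_inv_of_blockTriangular hb hij

/-- A triangular factor `V` of a matrix `V Vᵀ ≥ t` is invertible, with `‖V⁻¹‖² ≤ t⁻¹`. -/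
lemma triangular_factor_inv {V : Matrix n n ℝ} (hV : ∀ i j, i < j → V i j = 0) {t : ℝ}
    (ht : 0 < t) (h : ∀ x : n → ℝ, t * (x ⬝ᵥ x) ≤ x ⬝ᵥ ((V * Vᵀ) *ᵥ x)) :
    IsUnit V.det ∧ SpectralSqLe V⁻¹ t⁻¹ ∧ ∀ k, V k k ≠ 0 ∧ ((V k k)⁻¹) ^ 2 ≤ t⁻¹ := by
  have hq : ∀ x : n → ℝ, t * (x ⬝ᵥ x) ≤ (Vᵀ *ᵥ x) ⬝ᵥ (Vᵀ *ᵥ x) := by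
    intro x
    rw [mulVec_dotProduct_mulVec, transpose_transpose]
    exact h x
  have hu : IsUnit V.det := by
    rw [← det_transpose, ← isUnit_iff_isUnit_det, ← mulVec_injective_iff_isUnit]
    intro x y hxy
    have h0 : Vᵀ *ᵥ (x - y) = 0 := by rw [mulVec_sub]; exact sub_eq_zero.2 hxy
    have h1 := hq (x - y)
    rw [h0, dotProduct_zero] at h1
    have h2 : (x - y) ⬝ᵥ (x - y) = 0 :=
      le_antisymm (nonpos_of_mul_nonpos_right h1 ht) (dotProduct_self_nonneg' _)
    exact sub_eq_zero.1 (dotProduct_self_eq_zero.1 h2)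
  have hT : SpectralSqLe (V⁻¹)ᵀ t⁻¹ := by
    intro y
    have h1 := hq ((V⁻¹)ᵀ *ᵥ y)
    rw [mulVec_mulVec, ← transpose_mul, nonsing_inv_mul _ hu, transpose_one, one_mulVec] at h1
    rw [inv_mul_eq_div, le_div_iff₀ ht]
    linarith
  refine ⟨hu, by simpa using hT.transpose (inv_nonneg.2 ht.le), fun k => ?_⟩
  have hprod : V⁻¹ k k * V k k = 1 := by
    rw [← lowerTriangular_mul_diag (lowerTriangular_inv hV hu) hV, nonsing_inv_mul _ hu, one_apply_eq]
  have hne : V k k ≠ 0 := right_ne_zero_of_mul_eq_one hprod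
  refine ⟨hne, ?_⟩
  rw [← eq_inv_of_mul_eq_one_left hprod]
  have h1 := hT (Pi.single k 1)
  -- The reciprocal pivot is an entry of column `k` of `V⁻ᵀ`, so the norm of that column bounds it.
  rw [mulVec_single_one, dotProduct_single, Pi.single_eq_same, mul_one, mul_one] at h1
  refine le_trans ?_ h1
  rw [sq]
  exact Finset.single_le_sum (f := fun j => (V⁻¹)ᵀ.col k j * (V⁻¹)ᵀ.col k j)
    (fun j _ => mul_self_nonneg _) (Finset.mem_univ k)

/-- The strictly lower triangular part. -/
def strictLower (M : Matrix n n ℝ) : Matrix n n ℝ :=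
  Matrix.of fun i j => if j < i then M i j else 0

lemma norm_strictLower_le (M : Matrix n n ℝ) : ‖strictLower M‖ ≤ ‖M‖ := by
  have := frobenius_le_of_entry (A := strictLower M) (B := M) zero_le_one fun i j => by
    rw [strictLower, of_apply, one_mul]
    split_ifs
    · exact le_rfl
    · simp
  simpa using this

/-- Perturbation identity for triangular factors. -/
lemma triangular_factor_sub {U V : Matrix n n ℝ} (hU : ∀ i j, i < j → U i j = 0)
    (hV : ∀ i j, i < j → V i j = 0) (hUu : IsUnit U.det) (hVu : IsUnit V.det)
    (hV0 : ∀ k, V k k ≠ 0) :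
    V * diagonal (fun k => (V k k)⁻¹) - U * diagonal (fun k => (U k k)⁻¹)
      = U * strictLower (U⁻¹ * (V * Vᵀ - U * Uᵀ) * (V⁻¹)ᵀ) * diagonal (fun k => (V k k)⁻¹) := by
  have hUi := lowerTriangular_inv hU hUu
  have hVi := lowerTriangular_inv hV hVu
  have e1 : U⁻¹ * (V * Vᵀ - U * Uᵀ) * (V⁻¹)ᵀ = U⁻¹ * V - (V⁻¹ * U)ᵀ := by
    have h1 : Vᵀ * (V⁻¹)ᵀ = 1 := by rw [← transpose_mul, nonsing_inv_mul _ hVu, transpose_one]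
    have h2 : U⁻¹ * U = 1 := nonsing_inv_mul _ hUu
    rw [Matrix.mul_sub, Matrix.sub_mul, transpose_mul, ← Matrix.mul_assoc U⁻¹ U, h2, Matrix.one_mul,
      ← Matrix.mul_assoc, Matrix.mul_assoc _ Vᵀ, h1, Matrix.mul_one]
  -- By `e1` the matrix is a lower minus an upper triangular one, so its strictly lower part sees
  -- only `U⁻¹ V` without the diagonal.
  have e2 : strictLower (U⁻¹ * (V * Vᵀ - U * Uᵀ) * (V⁻¹)ᵀ)
      = U⁻¹ * V - diagonal fun k => (U k k)⁻¹ * V k k := by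
    rw [e1]
    ext i j
    rw [strictLower, of_apply, Matrix.sub_apply, Matrix.sub_apply, transpose_apply]
    split_ifs with h
    · rw [lowerTriangular_mul hVi hU j i h, diagonal_apply_ne _ h.ne']
    · rcases (not_lt.1 h).eq_or_lt with rfl | h
      · rw [diagonal_apply_eq, lowerTriangular_mul_diag hUi hV]
        have : U⁻¹ i i = (U i i)⁻¹ := by
          refine eq_inv_of_mul_eq_one_left ?_
          rw [← lowerTriangular_mul_diag hUi hU, nonsing_inv_mul _ hUu, one_apply_eq]
        rw [this, sub_self]
      · rw [lowerTriangular_mul hUi hV i j h, diagonal_apply_ne _ h.ne, sub_zero]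
  have e3 : diagonal (fun k => (U k k)⁻¹ * V k k) * diagonal (fun k => (V k k)⁻¹)
      = diagonal fun k => (U k k)⁻¹ := by
    rw [diagonal_mul_diagonal]
    congr 1
    ext k
    rw [mul_assoc, mul_inv_cancel₀ (hV0 k), mul_one]
  rw [e2, Matrix.mul_sub, Matrix.sub_mul, ← Matrix.mul_assoc U, mul_nonsing_inv _ hUu,
    Matrix.one_mul, Matrix.mul_assoc U (diagonal _), e3]

end LowerTriangular

/-! ### Perturbation of the LDL decomposition -/

section Perturbation

variable {d : ℕ} {K L V : Matrix (Fin (d + 1)) (Fin (d + 1)) ℝ} {δ : Fin (d + 1) → ℝ}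

lemma one_le_quadratic_form (hK : (K - 1).PosSemidef) (x : Fin (d + 1) → ℝ) :
    x ⬝ᵥ x ≤ x ⬝ᵥ (K *ᵥ x) := by
  have := hK.dotProduct_mulVec_nonneg x
  rw [sub_mulVec, one_mulVec, dotProduct_sub, star_trivial] at this
  linarith

lemma quadratic_form_le {s : ℝ} (hK : (s • 1 - K).PosSemidef) (x : Fin (d + 1) → ℝ) :
    x ⬝ᵥ (K *ᵥ x) ≤ s * (x ⬝ᵥ x) := by
  have := hK.dotProduct_mulVec_nonneg x
  rw [sub_mulVec, smul_mulVec, one_mulVec, dotProduct_sub, star_trivial, dotProduct_smul,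
    smul_eq_mul] at this
  linarith

/-- The Cholesky factor obtained from an LDL decomposition. -/
lemma IsLDL.exists_cholesky (hL : IsLDL K L δ) (hK : (K - 1).PosSemidef) :
    ∃ U : Matrix (Fin (d + 1)) (Fin (d + 1)) ℝ, (∀ i j, i < j → U i j = 0) ∧ U * Uᵀ = K ∧
      ((∀ k, U k k ≠ 0) → U * diagonal (fun k => (U k k)⁻¹) = L) := by
  obtain ⟨hdiag, hlow, hfac⟩ := hL
  have hu : IsUnit L.det := by
    have hb : BlockTriangular L OrderDual.toDual := fun i j h => hlow i j h
    rw [det_of_isLowerTriangular L hb]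
    simp [hdiag]
  -- At the vector `L⁻ᵀ e_k` the quadratic form of `K` takes the value `δ k`.
  have hδ : ∀ k, 0 ≤ δ k := by
    intro k
    have h1 := one_le_quadratic_form hK ((L⁻¹)ᵀ *ᵥ Pi.single k 1)
    have e : ((L⁻¹)ᵀ *ᵥ Pi.single k 1) ⬝ᵥ (K *ᵥ ((L⁻¹)ᵀ *ᵥ Pi.single k 1)) = δ k := by
      have h2 : Lᵀ * (L⁻¹)ᵀ = 1 := by rw [← transpose_mul, nonsing_inv_mul _ hu, transpose_one]
      rw [hfac, mulVec_mulVec, Matrix.mul_assoc, h2, Matrix.mul_one, mulVec_transpose,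
        ← dotProduct_mulVec, mulVec_mulVec, ← Matrix.mul_assoc, nonsing_inv_mul _ hu,
        Matrix.one_mul]
      simp
    rw [e] at h1
    exact (dotProduct_self_nonneg' _).trans h1
  refine ⟨L * diagonal fun k => √(δ k), fun i j h => ?_, ?_, fun h0 => ?_⟩
  · rw [mul_diagonal, hlow i j h, zero_mul]
  · rw [transpose_mul, diagonal_transpose, hfac, Matrix.mul_assoc, Matrix.mul_assoc,
      ← Matrix.mul_assoc (diagonal _) (diagonal _), diagonal_mul_diagonal]
    simp only [Real.mul_self_sqrt (hδ _)]
  · simp only [mul_diagonal, hdiag, one_mul] at h0 ⊢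
    rw [Matrix.mul_assoc, diagonal_mul_diagonal]
    simp only [mul_inv_cancel₀ (h0 _), diagonal_one, Matrix.mul_one]

lemma perturbed_quadratic_form_ge (hK : (K - 1).PosSemidef) (hE : ‖V * Vᵀ - K‖ ≤ 1 / 2)
    (x : Fin (d + 1) → ℝ) : 1 / 2 * (x ⬝ᵥ x) ≤ x ⬝ᵥ ((V * Vᵀ) *ᵥ x) := by
  have h1 := one_le_quadratic_form hK x
  have h2 := (abs_le.1 (abs_dotProduct_mulVec_le (V * Vᵀ - K) x)).1
  rw [sub_mulVec, dotProduct_sub] at h2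
  nlinarith [dotProduct_self_nonneg' x]

/-- In the perturbation identity the spectral norms are at most `√s` for `U`, 1 for `U⁻¹`, and `√2`
for each of `V⁻¹` and the reciprocal diagonal of `V`. Truncation to the strictly lower part does not
increase the Frobenius norm, so no logarithm appears. -/
lemma ldl_perturbation (hL : IsLDL K L δ) (hK : (K - 1).PosSemidef) {s : ℝ} (hs : 0 ≤ s)
    (hKs : (s • 1 - K).PosSemidef) (hV : ∀ i j, i < j → V i j = 0)
    (hE : ‖V * Vᵀ - K‖ ≤ 1 / 2) :
    ‖V * diagonal (fun k => (V k k)⁻¹) - L‖ ≤ 2 * √s * ‖V * Vᵀ - K‖ := by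
  obtain ⟨U, hU, rfl, hUL⟩ := hL.exists_cholesky hK
  obtain ⟨hVu, hVs, hVd⟩ := triangular_factor_inv hV (by norm_num : (0 : ℝ) < 1 / 2)
    (perturbed_quadratic_form_ge hK hE)
  obtain ⟨hUu, hUs, hUd⟩ := triangular_factor_inv hU one_pos fun x => by
    rw [one_mul]; exact one_le_quadratic_form hK x
  rw [← hUL fun k => (hUd k).1, triangular_factor_sub hU hV hUu hVu fun k => (hVd k).1]
  have hUop : SpectralSqLe U s := by
    have : SpectralSqLe Uᵀ s := fun x => by
      rw [mulVec_dotProduct_mulVec, transpose_transpose]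
      exact quadratic_form_le hKs x
    simpa using this.transpose hs
  set E := V * Vᵀ - U * Uᵀ
  have h2 : (0 : ℝ) ≤ (1 / 2)⁻¹ := by norm_num
  have hd : ∀ k, |(V k k)⁻¹| ≤ √(1 / 2)⁻¹ := fun k => Real.abs_le_sqrt (hVd k).2
  have hlast : ∀ M : Matrix (Fin (d + 1)) (Fin (d + 1)) ℝ,
      ‖M * diagonal (fun k => (V k k)⁻¹)‖ ≤ √(1 / 2)⁻¹ * ‖M‖ := by
    intro M
    refine frobenius_le_of_entry (Real.sqrt_nonneg _) fun i k => ?_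
    rw [mul_diagonal, abs_mul, mul_comm]
    gcongr
    exact hd k
  have hUE := hUs.norm_mul_le (by norm_num) E
  rw [inv_one, Real.sqrt_one, one_mul] at hUE
  calc _ ≤ √(1 / 2)⁻¹ * ‖U * strictLower (U⁻¹ * E * (V⁻¹)ᵀ)‖ := hlast _
    _ ≤ √(1 / 2)⁻¹ * (√s * ‖strictLower (U⁻¹ * E * (V⁻¹)ᵀ)‖) := by
      gcongr; exact hUop.norm_mul_le hs _
    _ ≤ √(1 / 2)⁻¹ * (√s * ‖U⁻¹ * E * (V⁻¹)ᵀ‖) := by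
      gcongr; exact norm_strictLower_le _
    _ ≤ √(1 / 2)⁻¹ * (√s * (√(1 / 2)⁻¹ * ‖U⁻¹ * E‖)) := by
      gcongr; exact hVs.norm_mul_transpose_le h2 _
    _ ≤ √(1 / 2)⁻¹ * (√s * (√(1 / 2)⁻¹ * ‖E‖)) := by gcongr
    _ = (√(1 / 2)⁻¹ * √(1 / 2)⁻¹) * √s * ‖E‖ := by ring
    _ = 2 * √s * ‖E‖ := by rw [Real.mul_self_sqrt h2]; norm_num

end Perturbation

/-! ### Forward error -/

section ForwardError

variable {ε : ℝ} (A : FloatArith ε) (m : QRMethod) {d : ℕ}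

/-- The shifted term vanishes in the corner, so `(G Gᵀ)₀₀ = K₀₀ ≥ 1`. This makes the smallness
hypothesis of the forward bound imply that of the backward bound. -/
lemma one_le_generator_norm_sq {K : Matrix (Fin (d + 1)) (Fin (d + 1)) ℝ}
    {G : Matrix (Fin (d + 1)) (Fin 2) ℝ}
    (hG : K - lowerShift d * K * (lowerShift d)ᵀ = G * Gᵀ) (hK : (K - 1).PosSemidef) :
    1 ≤ ‖G‖ ^ 2 := by
  have h1 : 0 ≤ (K - 1) 0 0 := hK.diag_nonneg
  rw [Matrix.sub_apply, one_apply_eq] at h1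
  have h2 := congrFun (congrFun hG 0) 0
  have h3 : (lowerShift d * K * (lowerShift d)ᵀ) 0 0 = 0 := by
    simp [Matrix.mul_apply, lowerShift]
  rw [Matrix.sub_apply, h3, sub_zero] at h2
  have h4 : (G * Gᵀ) 0 0 ≤ ‖G‖ ^ 2 := by
    rw [frobenius_sq]
    have := Finset.single_le_sum (f := fun i => ∑ j, G i j ^ 2)
      (fun i _ => Finset.sum_nonneg fun j _ => sq_nonneg (G i j)) (Finset.mem_univ 0)
    simpa [Matrix.mul_apply, sq] using this
  linarith

lemma one_le_of_spectrum {K : Matrix (Fin (d + 1)) (Fin (d + 1)) ℝ} {s : ℝ}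
    (hK : (K - 1).PosSemidef) (hKs : (s • 1 - K).PosSemidef) : 1 ≤ s := by
  have h1 : 0 ≤ (K - 1) 0 0 := hK.diag_nonneg
  have h2 : 0 ≤ (s • 1 - K) 0 0 := hKs.diag_nonneg
  simp at h1 h2
  linarith

lemma forward_error (hd : 1 ≤ d) {K : Matrix (Fin (d + 1)) (Fin (d + 1)) ℝ}
    {G : Matrix (Fin (d + 1)) (Fin 2) ℝ}
    (hG : K - lowerShift d * K * (lowerShift d)ᵀ = G * Gᵀ) {η : ℝ} (hη : 0 < η)
    (hK : (K - 1).PosSemidef) (hKs : (η⁻¹ • 1 - K).PosSemidef)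
    (hsmall : (d : ℝ) ^ 3 * ‖G‖ ^ 2 * ε ≤ 1 / 10000 * √η) :
    NoBreakdown A m G ∧ ∀ (L : Matrix (Fin (d + 1)) (Fin (d + 1)) ℝ) (δ : Fin (d + 1) → ℝ),
      IsLDL K L δ → ‖computedL A m G - L‖ ≤ 10000 * (d : ℝ) ^ 3 * η⁻¹ * ‖G‖ ^ 2 * ε := by
  have hε := A.nonneg
  have hd' : (1 : ℝ) ≤ d := by exact_mod_cast hd
  have hG1 := one_le_generator_norm_sq hG hK
  have hη1 : 1 ≤ η⁻¹ := one_le_of_spectrum hK hKs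
  have hsη : √η ≤ 1 := by
    have := (one_le_inv₀ hη).1 hη1
    exact Real.sqrt_le_iff.2 ⟨by norm_num, by linarith⟩
  have hd23 : (d : ℝ) ^ 2 ≤ (d : ℝ) ^ 3 := pow_le_pow_right₀ hd' (by norm_num)
  have hd13 : (d : ℝ) ≤ (d : ℝ) ^ 3 := le_self_pow₀ hd' (by norm_num)
  have hQ : (d : ℝ) ^ 3 * ‖G‖ ^ 2 * ε ≤ 1 / 10000 := by linarith
  have hde : (d : ℝ) * ε ≤ 1 / 10000 := by
    calc (d : ℝ) * ε = d * 1 * ε := by ring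
      _ ≤ (d : ℝ) ^ 3 * ‖G‖ ^ 2 * ε := by gcongr
      _ ≤ _ := hQ
  have hs := precision_le hd hde
  have hE0 := computedU_backward_error A m hd hde hG
  have hE : ‖computedU A m G * (computedU A m G)ᵀ - K‖ ≤ 4000 * ((d : ℝ) ^ 3 * ‖G‖ ^ 2 * ε) := by
    refine hE0.trans ?_
    have : (d : ℝ) ^ 2 * (‖G‖ ^ 2 * ε) ≤ (d : ℝ) ^ 3 * (‖G‖ ^ 2 * ε) := by gcongr
    linarith
  -- The choice `c = 1/10000` gives `4000 c = 0.4`.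
  have hE2 : ‖computedU A m G * (computedU A m G)ᵀ - K‖ ≤ 1 / 2 := by linarith
  have hlow : ∀ i j, i < j → computedU A m G i j = 0 := fun i j h =>
    computedU_lowerTriangular A m G h
  obtain ⟨-, -, hdiag⟩ := triangular_factor_inv hlow (by norm_num : (0 : ℝ) < 1 / 2)
    (perturbed_quadratic_form_ge hK hE2)
  have hNB : NoBreakdown A m G := fun k => (hdiag k).1
  refine ⟨hNB, fun L δ hL => ?_⟩
  have hpert := ldl_perturbation hL hK (inv_nonneg.2 hη.le) hKs hlow hE2
  have hround := computedL_error A m hNB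
  have hL' : computedU A m G * diagonal (fun k => (computedU A m G k k)⁻¹)
      = Matrix.of fun i k => computedU A m G i k / computedU A m G k k := by
    ext i k
    rw [mul_diagonal, of_apply, div_eq_mul_inv]
  rw [hL'] at hpert
  set L' := Matrix.of fun i k => computedU A m G i k / computedU A m G k k with hLdef
  have hLnorm : ‖L'‖ ≤ 4 * (d : ℝ) ^ 3 * ‖G‖ ^ 2 := by
    have h1 : ‖L'‖ ≤ 2 * ‖computedU A m G‖ := by
      refine frobenius_le_of_entry (by norm_num) fun i k => ?_
      rw [hLdef, of_apply, div_eq_mul_inv, abs_mul, mul_comm]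
      gcongr
      refine abs_le_of_sq_le_sq ((hdiag k).2.trans (by norm_num)) (by norm_num)
    have h2 := norm_computedU_sq_le A m hd hde G
    have h3 : ‖computedU A m G‖ ≤ 2 * ((d : ℝ) ^ 3 * ‖G‖ ^ 2) := by
      refine (abs_le_of_sq_le_sq' ?_ (by positivity)).2
      have h4 : (d : ℝ) * ‖G‖ ^ 2 ≤ (d : ℝ) ^ 3 * ‖G‖ ^ 2 := by gcongr
      have h5 : 1 ≤ (d : ℝ) ^ 3 * ‖G‖ ^ 2 := by nlinarith
      nlinarith
    linarith
  -- The perturbation bound only needs `√η⁻¹`; it is weakened here to `η⁻¹`. The final count is `4 +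
  -- 8000 ≤ 10000`.
  have hsq : √η⁻¹ ≤ η⁻¹ := Real.sqrt_le_iff.2 ⟨by positivity, by nlinarith⟩
  have htri := norm_add_le (computedL A m G - L') (L' - L)
  rw [sub_add_sub_cancel] at htri
  have hQ0 : 0 ≤ (d : ℝ) ^ 3 * ‖G‖ ^ 2 * ε := by positivity
  calc ‖computedL A m G - L‖ ≤ ε * ‖L'‖
        + 2 * √η⁻¹ * ‖computedU A m G * (computedU A m G)ᵀ - K‖ :=
        htri.trans (add_le_add hround hpert)
    _ ≤ ε * (4 * (d : ℝ) ^ 3 * ‖G‖ ^ 2) + 2 * η⁻¹ * (4000 * ((d : ℝ) ^ 3 * ‖G‖ ^ 2 * ε)) := by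
      gcongr
    _ ≤ 10000 * (d : ℝ) ^ 3 * η⁻¹ * ‖G‖ ^ 2 * ε := by nlinarith

end ForwardError

/-! ### Laurent coefficients of `b / a` -/

section LaurentCoefficients

open Polynomial

lemma IsTarget.coeff_odd {d : ℕ} {η : ℝ} {f : ℝ[X]} (hf : IsTarget d η f) (l : ℕ) :
    f.coeff (2 * l + 1) = 0 := by
  have h := congrArg (fun g => g.coeff (2 * l + 1)) hf.2.1
  have e : (-X : ℝ[X]) = C (-1) * X := by simp
  simp only [e, comp_C_mul_X_coeff, Odd.neg_one_pow ⟨l, rfl⟩] at h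
  linarith

lemma sum_range_even {g : ℕ → ℂ} (h : ∀ l, g (2 * l + 1) = 0) (d : ℕ) :
    ∑ i ∈ Finset.range (2 * d + 1), g i = ∑ l ∈ Finset.range (d + 1), g (2 * l) := by
  induction d with
  | zero => simp
  | succ d ih =>
    rw [show 2 * (d + 1) + 1 = 2 * d + 1 + 1 + 1 by ring, Finset.sum_range_succ,
      Finset.sum_range_succ, ih, h, Finset.sum_range_succ _ (d + 1)]
    ring_nf

/-- The polynomial function `w^d f(cos (t/2))` of `w = e^{-it}`. -/
noncomputable def targetNumerator (d : ℕ) (f : ℝ[X]) (w : ℂ) : ℂ :=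
  ∑ l ∈ Finset.range (d + 1), (f.coeff (2 * l) : ℂ) * (w ^ (d - l) * ((1 + w) ^ 2 / 4) ^ l)

/-- Evenness of `f` leaves only powers of `cos² (t/2)`, and each factor `w` turns one of them into a
polynomial in `w = e^{-it}`. Hence `w^d f` has no half-integer or negative powers. -/
lemma cos_half_sq (t : ℝ) :
    Complex.exp (-(t * Complex.I)) * ((Real.cos (t / 2) : ℝ) : ℂ) ^ 2
      = (1 + Complex.exp (-(t * Complex.I))) ^ 2 / 4 := by
  have h : Complex.exp (-(t * Complex.I)) = Complex.exp (-(t / 2 * Complex.I)) ^ 2 := by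
    rw [← Complex.exp_nat_mul]; congr 1; push_cast; ring
  have h1 : Complex.exp (t / 2 * Complex.I) * Complex.exp (-(t / 2 * Complex.I)) = 1 := by
    rw [← Complex.exp_add]; simp
  rw [Complex.ofReal_cos, Complex.cos, h]
  push_cast
  rw [← neg_mul] at h1 ⊢
  set u := Complex.exp (t / 2 * Complex.I)
  set v := Complex.exp (-(t / 2) * Complex.I)
  linear_combination (u * v + 1 + 2 * v ^ 2) / 4 * h1

lemma IsTarget.exp_mul_eval {d : ℕ} {η : ℝ} {f : ℝ[X]} (hf : IsTarget d η f) (t : ℝ) :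
    Complex.exp (-(t * Complex.I)) ^ d * ((f.eval (Real.cos (t / 2)) : ℝ) : ℂ)
      = targetNumerator d f (Complex.exp (-(t * Complex.I))) := by
  have hcos := cos_half_sq t
  set w := Complex.exp (-(t * Complex.I))
  rw [eval_eq_sum_range' (Nat.lt_succ_of_le hf.1)]
  push_cast
  rw [sum_range_even (fun l => by rw [hf.coeff_odd]; simp), targetNumerator, Finset.mul_sum]
  refine Finset.sum_congr rfl fun l hl => ?_
  have hl' : l ≤ d := Nat.lt_succ_iff.1 (Finset.mem_range.1 hl)
  rw [← hcos, mul_pow, ← pow_mul, ← mul_assoc (w ^ (d - l)), ← pow_add, Nat.sub_add_cancel hl',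
    Complex.ofReal_cos]
  push_cast
  ring

variable {d : ℕ} {η : ℝ} {f : ℝ[X]} {P : ℂ[X]}

lemma IsTarget.eval_sq_le (hη : 0 < η) (hη1 : η < 1) (hf : IsTarget d η f) (t : ℝ) :
    f.eval (Real.cos (t / 2)) ^ 2 ≤ 1 - η := by
  have h := hf.2.2 _ ⟨Real.neg_one_le_cos (t / 2), Real.cos_le_one (t / 2)⟩
  rw [← sq_abs]
  nlinarith [abs_nonneg (f.eval (Real.cos (t / 2)))]

lemma IsOuterComplement.eval_exp_ne_zero (hη : 0 < η) (hη1 : η < 1) (hf : IsTarget d η f)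
    (hP : IsOuterComplement f P) (t : ℝ) : P.eval (Complex.exp (-(t * Complex.I))) ≠ 0 := by
  intro h0
  have h := hP.2.2 t
  rw [h0, norm_zero] at h
  have := hf.eval_sq_le hη hη1 t
  linarith

/-- Outerness covers the open disk; on the circle `|P|² = 1 - f² ≥ η`. -/
lemma IsOuterComplement.eval_ne_zero (hη : 0 < η) (hη1 : η < 1) (hf : IsTarget d η f)
    (hP : IsOuterComplement f P) {w : ℂ} (hw : ‖w‖ ≤ 1) : P.eval w ≠ 0 := by
  rcases hw.eq_or_lt with h | h
  · have e : w = Complex.exp (-(((-w.arg : ℝ) : ℂ) * Complex.I)) := by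
      nth_rewrite 1 [← Complex.norm_mul_exp_arg_mul_I w]
      rw [h]
      simp
    rw [e]
    exact hP.eval_exp_ne_zero hη hη1 hf _
  · exact hP.1 w h

/-- The mean value property, after the substitution `t ↦ 2π - t` that reverses the circle. -/
lemma integral_exp_neg_eq_zero {F : ℂ → ℂ} (hF : DifferentiableOn ℂ F (Metric.closedBall 0 1))
    (h0 : F 0 = 0) :
    ∫ t in (0 : ℝ)..(2 * Real.pi), F (Complex.exp (-(t * Complex.I))) = 0 := by
  have h1 : Real.circleAverage F 0 1 = F 0 := by
    refine DiffContOnCl.circleAverage ?_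
    rw [abs_one]
    exact DifferentiableOn.diffContOnCl_ball hF subset_rfl
  rw [h0, Real.circleAverage_def, smul_eq_zero] at h1
  have h2 := h1.resolve_left (by positivity)
  have h3 := intervalIntegral.integral_comp_sub_left (a := 0) (b := 2 * Real.pi)
    (fun s : ℝ => F (circleMap 0 1 s)) (2 * Real.pi)
  rw [sub_self, sub_zero, h2] at h3
  rw [← h3]
  refine intervalIntegral.integral_congr fun t _ => ?_
  simp only [circleMap]
  congr 1
  rw [zero_add, Complex.ofReal_one, one_mul]
  push_cast
  rw [sub_mul, Complex.exp_sub, Complex.exp_two_pi_mul_I, one_div, ← Complex.exp_neg]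

/-- `b / a` has no Laurent coefficients of index greater than `d`. -/
lemma laurentCoeff_eq_zero (hη : 0 < η) (hη1 : η < 1) (hf : IsTarget d η f)
    (hP : IsOuterComplement f P) {n : ℕ} (hn : n ≠ 0) : laurentCoeff f P ((d : ℤ) + n) = 0 := by
  -- In `w = e^{-it}` the index `d` clears the denominators of `f`, and the surplus `w ^ n` makes
  -- the function vanish at the origin.
  have h := integral_exp_neg_eq_zero
    (F := fun w => Complex.I * targetNumerator d f w / P.eval w * w ^ n) ?_ (by simp [hn])
  · rw [laurentCoeff]
    refine mul_eq_zero_of_right _ ?_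
    rw [← h]
    refine intervalIntegral.integral_congr fun t _ => ?_
    simp only [← hf.exp_mul_eval]
    have e : Complex.exp (-(((d : ℤ) + n : ℤ) * t * Complex.I))
        = Complex.exp (-(t * Complex.I)) ^ d * Complex.exp (-(t * Complex.I)) ^ n := by
      rw [← pow_add, ← Complex.exp_nat_mul]
      congr 1
      push_cast
      ring
    rw [e]
    ring
  · intro w hw
    have hw' := hP.eval_ne_zero hη hη1 hf (mem_closedBall_zero_iff.1 hw)
    unfold targetNumerator
    refine DifferentiableAt.differentiableWithinAt ?_
    have hPd := P.differentiable w
    fun_prop (disch := assumption)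

/-- The values of `b / a` on the unit circle. -/
noncomputable def symbol (f : ℝ[X]) (P : ℂ[X]) (t : ℝ) : ℂ :=
  Complex.I * (f.eval (Real.cos (t / 2)) : ℝ) / P.eval (Complex.exp (-(t * Complex.I)))

lemma norm_symbol_sq_le (hη : 0 < η) (hη1 : η < 1) (hf : IsTarget d η f)
    (hP : IsOuterComplement f P) (t : ℝ) : ‖symbol f P t‖ ^ 2 ≤ η⁻¹ - 1 := by
  have h1 := hf.eval_sq_le hη hη1 t
  have h2 := hP.2.2 t
  have h3 : ‖P.eval (Complex.exp (-(t * Complex.I)))‖ ^ 2 = 1 - f.eval (Real.cos (t / 2)) ^ 2 := by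
    linarith
  have hpos : 0 < 1 - f.eval (Real.cos (t / 2)) ^ 2 := by linarith
  rw [symbol, norm_div, norm_mul, Complex.norm_I, one_mul, Complex.norm_real, div_pow, h3,
    Real.norm_eq_abs, sq_abs, div_le_iff₀ hpos]
  have h4 : η⁻¹ * η = 1 := inv_mul_cancel₀ hη.ne'
  have h5 : 0 < η⁻¹ := inv_pos.2 hη
  nlinarith

lemma continuous_symbol (hη : 0 < η) (hη1 : η < 1) (hf : IsTarget d η f)
    (hP : IsOuterComplement f P) : Continuous (symbol f P) := by
  have h0 := hP.eval_exp_ne_zero hη hη1 hf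
  unfold symbol
  refine Continuous.div ?_ ?_ h0
  · have := f.continuous
    fun_prop
  · have := P.continuous
    fun_prop

end LaurentCoefficients

/-! ### The Toeplitz matrix `B` and its displacement -/

section Toeplitz

open Polynomial

variable {d : ℕ}

/-- The value at `w` of the polynomial with coefficients `x`. -/
noncomputable def vecEval (x : Fin (d + 1) → ℝ) (w : ℂ) : ℂ := ∑ j, (x j : ℂ) * w ^ (j : ℕ)

lemma continuous_vecEval (x : Fin (d + 1) → ℝ) : Continuous (vecEval x) := by
  unfold vecEval
  fun_prop

lemma norm_vecEval_conj (x : Fin (d + 1) → ℝ) (w : ℂ) :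
    ‖vecEval x (starRingEnd ℂ w)‖ = ‖vecEval x w‖ := by
  rw [← Complex.norm_conj (vecEval x w)]
  simp [vecEval]

/-- Parseval's identity on the unit circle. -/
lemma integral_vecEval_sq (x : Fin (d + 1) → ℝ) :
    ∫ t in (0 : ℝ)..(2 * Real.pi), ‖vecEval x (Complex.exp (t * Complex.I))‖ ^ 2
      = 2 * Real.pi * (x ⬝ᵥ x) := by
  set p : ℂ[X] := ∑ j : Fin (d + 1), C (x j : ℂ) * X ^ (j : ℕ) with hp
  have hcoeff : ∀ j : Fin (d + 1), p.coeff j = x j := by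
    intro j
    simp only [hp, finsetSum_coeff, coeff_C_mul, coeff_X_pow, mul_ite, mul_one, mul_zero]
    rw [Finset.sum_eq_single j]
    · simp
    · intro i _ hi
      rw [if_neg fun h => hi (Fin.ext h.symm)]
    · simp
  have hdeg : p.support ⊆ Finset.range (d + 1) := by
    intro i hi
    by_contra hc
    rw [Finset.mem_range] at hc
    refine (mem_support_iff.1 hi) ?_
    simp only [hp, finsetSum_coeff, coeff_C_mul, coeff_X_pow, mul_ite, mul_one, mul_zero]
    refine Finset.sum_eq_zero fun j _ => if_neg ?_
    have := j.isLt
    omega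
  have h := p.sum_sq_norm_coeff_eq_circleAverage
  rw [Finset.sum_subset hdeg fun i _ hi => by rw [notMem_support_iff.1 hi]; simp,
    Finset.sum_range, Real.circleAverage_def] at h
  have e1 : ∑ j : Fin (d + 1), ‖p.coeff j‖ ^ 2 = x ⬝ᵥ x := by
    refine Finset.sum_congr rfl fun j _ => ?_
    rw [hcoeff, Complex.norm_real, Real.norm_eq_abs, sq_abs, sq]
  have e2 : ∀ t : ℝ, p.eval (circleMap 0 1 t) = vecEval x (Complex.exp (t * Complex.I)) := by
    intro t
    simp [hp, vecEval, eval_finsetSum, circleMap]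
  rw [e1] at h
  simp only [e2] at h
  rw [h, smul_eq_mul, ← mul_assoc, mul_inv_cancel₀ (by positivity), one_mul]

/-- Above the diagonal the index exceeds `d`, where the coefficient is zero. So one formula in `d -
i + j` covers all entries, as the integral representation of the bilinear form requires. -/
lemma lowerToeplitz_pVec_apply {η : ℝ} {f : ℝ[X]} {P : ℂ[X]} (hη : 0 < η) (hη1 : η < 1)
    (hf : IsTarget d η f) (hP : IsOuterComplement f P) (i j : Fin (d + 1)) :
    lowerToeplitz (pVec d f P) i j
      = (-Complex.I * laurentCoeff f P ((d : ℤ) - (i : ℤ) + (j : ℤ))).re := by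
  rw [lowerToeplitz, of_apply]
  split_ifs with h
  · rw [pVec, Fin.sub_val_of_le h, Nat.cast_sub (Fin.le_def.1 h)]
    congr 4
    ring
  · rw [not_le, Fin.lt_def] at h
    have e : (d : ℤ) - (i : ℤ) + (j : ℤ) = (d : ℤ) + ((j - i : ℕ) : ℤ) := by
      rw [Nat.cast_sub h.le]; ring
    rw [e, laurentCoeff_eq_zero hη hη1 hf hP (by omega)]
    simp

/-- A finite section of a Toeplitz operator is bounded by its symbol. -/
lemma lowerToeplitz_pVec_spectralSqLe {η : ℝ} {f : ℝ[X]} {P : ℂ[X]} (hη : 0 < η) (hη1 : η < 1)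
    (hf : IsTarget d η f) (hP : IsOuterComplement f P) :
    SpectralSqLe (lowerToeplitz (pVec d f P)) (η⁻¹ - 1) := by
  intro x
  set B := lowerToeplitz (pVec d f P) with hB
  set y := B *ᵥ x with hy
  have hcont := continuous_symbol hη hη1 hf hP
  have hπ := Real.pi_pos
  -- For `y = B x` the form `⟨y, B x⟩ = |y|²` becomes an integral against the symbol.
  have hint : ∑ i, ∑ j, (y i : ℂ) * (x j : ℂ) * laurentCoeff f P ((d : ℤ) - (i : ℤ) + (j : ℤ))
      = (1 / (2 * Real.pi) : ℝ) * ∫ t in (0 : ℝ)..(2 * Real.pi),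
        symbol f P t * Complex.exp (-(t * Complex.I)) ^ d
          * (vecEval y (Complex.exp (t * Complex.I)) * vecEval x (Complex.exp (-(t * Complex.I)))) := by
    have hexp : ∀ (t : ℝ) (i j : Fin (d + 1)),
        Complex.exp (-((((d : ℤ) - (i : ℤ) + (j : ℤ) : ℤ) : ℂ) * t * Complex.I))
          = Complex.exp (-(t * Complex.I)) ^ d * (Complex.exp (t * Complex.I) ^ (i : ℕ)
            * Complex.exp (-(t * Complex.I)) ^ (j : ℕ)) := by
      intro t i j
      rw [← Complex.exp_nat_mul, ← Complex.exp_nat_mul, ← Complex.exp_nat_mul, ← Complex.exp_add,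
        ← Complex.exp_add]
      congr 1
      push_cast
      ring
    have hfun : ∀ t : ℝ, symbol f P t * Complex.exp (-(t * Complex.I)) ^ d
          * (vecEval y (Complex.exp (t * Complex.I)) * vecEval x (Complex.exp (-(t * Complex.I))))
        = ∑ i, ∑ j, (y i : ℂ) * (x j : ℂ) * (symbol f P t *
          Complex.exp (-((((d : ℤ) - (i : ℤ) + (j : ℤ) : ℤ) : ℂ) * t * Complex.I))) := by
      intro t
      rw [vecEval, vecEval, Finset.sum_mul_sum]
      simp only [hexp, Finset.mul_sum]
      refine Finset.sum_congr rfl fun i _ => Finset.sum_congr rfl fun j _ => ?_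
      ring
    have hii : ∀ i j : Fin (d + 1), IntervalIntegrable (fun t : ℝ => (y i : ℂ) * (x j : ℂ) *
        (symbol f P t * Complex.exp (-((((d : ℤ) - (i : ℤ) + (j : ℤ) : ℤ) : ℂ) * t * Complex.I))))
        MeasureTheory.volume 0 (2 * Real.pi) := fun i j =>
      Continuous.intervalIntegrable (by fun_prop) _ _
    simp only [hfun]
    rw [intervalIntegral.integral_finsetSum fun i _ => Continuous.intervalIntegrable (by fun_prop) _ _,
      Finset.mul_sum]
    refine Finset.sum_congr rfl fun i _ => ?_
    rw [intervalIntegral.integral_finsetSum fun j _ => hii i j, Finset.mul_sum]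
    refine Finset.sum_congr rfl fun j _ => ?_
    rw [intervalIntegral.integral_const_mul, laurentCoeff]
    simp only [symbol]
    ring
  set T := ∑ i, ∑ j, (y i : ℂ) * (x j : ℂ) * laurentCoeff f P ((d : ℤ) - (i : ℤ) + (j : ℤ))
  have hre : y ⬝ᵥ y = (-Complex.I * T).re := by
    have : y ⬝ᵥ y = ∑ i, ∑ j, y i * (B i j * x j) := by
      nth_rewrite 2 [hy]
      simp only [dotProduct, mulVec, Finset.mul_sum]
    rw [this, Finset.mul_sum, Complex.re_sum]
    refine Finset.sum_congr rfl fun i _ => ?_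
    rw [Finset.mul_sum, Complex.re_sum]
    refine Finset.sum_congr rfl fun j _ => ?_
    rw [hB, lowerToeplitz_pVec_apply hη hη1 hf hP]
    rw [show ∀ z : ℂ, -Complex.I * ((y i : ℂ) * (x j : ℂ) * z)
      = ((y i * x j : ℝ) : ℂ) * (-Complex.I * z) by intro z; push_cast; ring, Complex.re_ofReal_mul]
    ring
  have hle : y ⬝ᵥ y ≤ ‖T‖ := by
    rw [hre]
    refine (Complex.re_le_norm _).trans ?_
    simp
  -- The inequality `2 s u v ≤ s² u² + v²` replaces Cauchy–Schwarz for integrals; the resulting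
  -- `|y|² / 2` is absorbed on the left at the end.
  have hpt : ∀ t : ℝ, ‖symbol f P t * Complex.exp (-(t * Complex.I)) ^ d
      * (vecEval y (Complex.exp (t * Complex.I)) * vecEval x (Complex.exp (-(t * Complex.I))))‖
      ≤ (η⁻¹ - 1) / 2 * ‖vecEval x (Complex.exp (t * Complex.I))‖ ^ 2
        + 1 / 2 * ‖vecEval y (Complex.exp (t * Complex.I))‖ ^ 2 := by
    intro t
    have h1 : ‖Complex.exp (-(t * Complex.I))‖ = 1 := by
      rw [← neg_mul, ← Complex.ofReal_neg, Complex.norm_exp_ofReal_mul_I]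
    have h2 : ‖vecEval x (Complex.exp (-(t * Complex.I)))‖
        = ‖vecEval x (Complex.exp (t * Complex.I))‖ := by
      rw [← norm_vecEval_conj, ← Complex.exp_conj]
      simp
    rw [norm_mul, norm_mul, norm_mul, norm_pow, h1, one_pow, mul_one, h2]
    have h3 := norm_symbol_sq_le hη hη1 hf hP t
    have h4 := mul_le_mul_of_nonneg_right h3 (sq_nonneg ‖vecEval x (Complex.exp (t * Complex.I))‖)
    nlinarith [sq_nonneg (‖symbol f P t‖ * ‖vecEval x (Complex.exp (t * Complex.I))‖
      - ‖vecEval y (Complex.exp (t * Complex.I))‖)]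
  have hcx := continuous_vecEval x
  have hcy := continuous_vecEval y
  have hT : ‖T‖ ≤ (η⁻¹ - 1) / 2 * (x ⬝ᵥ x) + 1 / 2 * (y ⬝ᵥ y) := by
    rw [hint, norm_mul, Complex.norm_real, Real.norm_eq_abs, abs_of_pos (by positivity)]
    have hmono := intervalIntegral.integral_mono_on (μ := MeasureTheory.volume)
      (by positivity : (0 : ℝ) ≤ 2 * Real.pi)
      (Continuous.intervalIntegrable (by fun_prop) _ _)
      (Continuous.intervalIntegrable (by fun_prop) _ _) fun t _ => hpt t
    rw [intervalIntegral.integral_add (Continuous.intervalIntegrable (by fun_prop) _ _)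
      (Continuous.intervalIntegrable (by fun_prop) _ _), intervalIntegral.integral_const_mul,
      intervalIntegral.integral_const_mul, integral_vecEval_sq, integral_vecEval_sq] at hmono
    have hnorm := (intervalIntegral.norm_integral_le_integral_norm
      (by positivity : (0 : ℝ) ≤ 2 * Real.pi)).trans hmono
    rw [one_div, inv_mul_le_iff₀ (by positivity)]
    linarith
  linarith

lemma lowerShift_conj_apply (M : Matrix (Fin (d + 1)) (Fin (d + 1)) ℝ) (i j : Fin (d + 1)) :
    (lowerShift d * M * (lowerShift d)ᵀ) i j
      = Fin.cases 0 (fun i' => Fin.cases 0 (fun j' => M i'.castSucc j'.castSucc) j) i := by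
  have h : (lowerShift d * M * (lowerShift d)ᵀ) i j
      = (lowerShift d *ᵥ fun k => (lowerShift d *ᵥ fun l => M l k) i) j := by
    rw [Matrix.mul_apply]
    simp only [mulVec, dotProduct, transpose_apply, Matrix.mul_apply]
    exact Finset.sum_congr rfl fun _ _ => mul_comm _ _
  rw [h]
  simp only [lowerShift_mulVec]
  cases i using Fin.cases <;> cases j using Fin.cases <;> simp

lemma lowerToeplitz_succ_succ (p : Fin (d + 1) → ℝ) (i j : Fin d) :
    lowerToeplitz p i.succ j.succ = lowerToeplitz p i.castSucc j.castSucc := by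
  simp only [lowerToeplitz, of_apply, Fin.succ_le_succ_iff, Fin.castSucc_le_castSucc_iff]
  split_ifs with h
  · congr 1
    ext
    rw [Fin.sub_val_of_le (by simpa using h), Fin.sub_val_of_le (by simpa using h)]
    simp
  · rfl

lemma lowerToeplitz_zero_right (p : Fin (d + 1) → ℝ) (i : Fin (d + 1)) :
    lowerToeplitz p i 0 = p i := by simp [lowerToeplitz]

lemma lowerToeplitz_of_lt (p : Fin (d + 1) → ℝ) {i j : Fin (d + 1)} (h : i < j) :
    lowerToeplitz p i j = 0 := by simp [lowerToeplitz, h]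

/-- The identity contributes `e₀ e₀ᵀ`. In `B Bᵀ`, splitting off the first column `p` leaves, by the
Toeplitz structure, the entries one step up the diagonal. -/
lemma displacement_startGenerator (p : Fin (d + 1) → ℝ) :
    let K := 1 + lowerToeplitz p * (lowerToeplitz p)ᵀ
    K - lowerShift d * K * (lowerShift d)ᵀ = startGenerator p * (startGenerator p)ᵀ := by
  intro K
  have hrow : ∀ j, (lowerToeplitz p * (lowerToeplitz p)ᵀ) 0 j = p 0 * p j := by
    intro j
    rw [Matrix.mul_apply, Fin.sum_univ_succ, Finset.sum_eq_zero fun k _ => by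
      rw [lowerToeplitz_of_lt p k.succ_pos, zero_mul], add_zero, transpose_apply,
      lowerToeplitz_zero_right, lowerToeplitz_zero_right]
  have hsymm : ∀ i j, (lowerToeplitz p * (lowerToeplitz p)ᵀ) i j
      = (lowerToeplitz p * (lowerToeplitz p)ᵀ) j i := by
    intro i j
    simp only [Matrix.mul_apply, transpose_apply]
    exact Finset.sum_congr rfl fun _ _ => mul_comm _ _
  ext i j
  rw [Matrix.sub_apply, lowerShift_conj_apply]
  simp only [K, Matrix.add_apply]
  rw [Matrix.mul_apply (M := startGenerator p), Fin.sum_univ_two]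
  simp only [startGenerator, transpose_apply, of_apply, cons_val_zero, cons_val_one,
    cons_val_fin_one]
  cases i using Fin.cases with
  | zero =>
    rw [hrow]
    cases j using Fin.cases <;> simp [Matrix.one_apply, (Fin.succ_ne_zero _).symm]
  | succ i =>
    cases j using Fin.cases with
    | zero =>
      rw [hsymm, hrow]
      simp [mul_comm]
    | succ j =>
      simp only [Fin.cases_succ]
      rw [Matrix.mul_apply, Matrix.mul_apply, Fin.sum_univ_succ,
        Fin.sum_univ_castSucc (f := fun k => lowerToeplitz p i.castSucc k
          * (lowerToeplitz p)ᵀ k j.castSucc)]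
      simp only [transpose_apply, lowerToeplitz_succ_succ, lowerToeplitz_zero_right,
        lowerToeplitz_of_lt p (Fin.castSucc_lt_last i), zero_mul, Matrix.one_apply, Fin.succ_inj,
        Fin.castSucc_inj, Fin.succ_ne_zero, if_false]
      ring

end Toeplitz

end HalfCholesky

open HalfCholesky Matrix

theorem theorem3 :
    ∃ C c : ℝ, 0 < C ∧ 0 < c ∧
      ∀ (d : ℕ) (ε : ℝ) (A : FloatArith ε) (m : QRMethod), 1 ≤ d →
        -- arbitrary generators
        (∀ (K : Matrix (Fin (d + 1)) (Fin (d + 1)) ℝ) (G : Matrix (Fin (d + 1)) (Fin 2) ℝ),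
          K - lowerShift d * K * (lowerShift d)ᵀ = G * Gᵀ →
            -- backward error
            ((d : ℝ) * ε ≤ c → NoBreakdown A m G →
              ‖computedL A m G * computedH A m G ^ 2 * (computedL A m G)ᵀ - K‖
                ≤ C * (d : ℝ) ^ 3 * ‖G‖ ^ 2 * ε) ∧
            -- forward error, for spectrum of `K` in `[1, η⁻¹]`
            (∀ η : ℝ, 0 < η → (K - 1).PosSemidef → (η⁻¹ • 1 - K).PosSemidef →
              (d : ℝ) ^ 3 * ‖G‖ ^ 2 * ε ≤ c * Real.sqrt η →
                NoBreakdown A m G ∧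
                ∀ (L : Matrix (Fin (d + 1)) (Fin (d + 1)) ℝ) (δ : Fin (d + 1) → ℝ), IsLDL K L δ →
                  ‖computedL A m G - L‖ ≤ C * (d : ℝ) ^ 3 * η⁻¹ * ‖G‖ ^ 2 * ε)) ∧
        -- forward error for the matrix `K = I + B Bᵀ` of a target polynomial in `S_η`
        (∀ (η : ℝ) (f : Polynomial ℝ) (P : Polynomial ℂ), 0 < η → η < 1 →
          IsTarget d η f → IsOuterComplement f P →
          ∀ (B K : Matrix (Fin (d + 1)) (Fin (d + 1)) ℝ) (G : Matrix (Fin (d + 1)) (Fin 2) ℝ),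
            B = lowerToeplitz (pVec d f P) → K = 1 + B * Bᵀ →
            G = startGenerator (pVec d f P) →
            (d : ℝ) ^ 3 * ‖G‖ ^ 2 * ε ≤ c * Real.sqrt η →
              NoBreakdown A m G ∧
              ∀ (L : Matrix (Fin (d + 1)) (Fin (d + 1)) ℝ) (δ : Fin (d + 1) → ℝ), IsLDL K L δ →
                ‖computedL A m G - L‖ ≤ C * (d : ℝ) ^ 3 * η⁻¹ * ‖G‖ ^ 2 * ε) := by
  refine ⟨10000, 1 / 10000, by norm_num, by norm_num, fun d ε A m hd => ⟨fun K G hG => ⟨?_, ?_⟩, ?_⟩⟩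
  · intro hde hNB
    have hε := A.nonneg
    refine (backward_error A m hd hde hG hNB).trans ?_
    gcongr
    norm_num
  · intro η hη hK hKs hsmall
    exact forward_error A m hd hG hη hK hKs hsmall
  · rintro η f P hη hη1 hf hP B K G hB hKB hGp hsmall
    have hBs : SpectralSqLe B (η⁻¹ - 1) := hB ▸ lowerToeplitz_pVec_spectralSqLe hη hη1 hf hP
    have hBT := hBs.transpose (by linarith [(one_le_inv₀ hη).2 hη1.le])
    have hH : (B * Bᵀ).IsHermitian := by
      simpa using isHermitian_mul_conjTranspose_self B
    have hquad : ∀ x, x ⬝ᵥ ((B * Bᵀ) *ᵥ x) = (Bᵀ *ᵥ x) ⬝ᵥ (Bᵀ *ᵥ x) := fun x => by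
      rw [mulVec_dotProduct_mulVec, transpose_transpose]
    refine forward_error A m hd ?_ hη ?_ ?_ hsmall
    · rw [hKB, hB, hGp]
      exact displacement_startGenerator _
    · rw [hKB, add_sub_cancel_left]
      simpa using posSemidef_self_mul_conjTranspose B
    -- The upper bound is `1 + ‖Bᵀ‖² ≤ 1 + (η⁻¹ - 1) = η⁻¹`.
    · refine PosSemidef.of_dotProduct_mulVec_nonneg ?_ fun x => ?_
      · rw [hKB]
        exact (isHermitian_one.smul (IsSelfAdjoint.all η⁻¹)).sub (isHermitian_one.add hH)
      · have := hBT x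
        rw [hKB, sub_mulVec, add_mulVec, smul_mulVec, one_mulVec, star_trivial, dotProduct_sub,
          dotProduct_add, hquad, dotProduct_smul, smul_eq_mul]
        linarith
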